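/- Consider a base station (BS) with $M$ antennas, a reflecting surface with $N\ge 1$ elements, $K_I$ information users (IUs) and $K_E$ energy users (EUs). The channel of IU $k$ is $\mathbf h_k=\sqrt{\beta_{BI,k}}\,\mathbf t_k$, $\beta_{BI,k}>0$, where $\mathbf t_k\in\mathbb C^M$ has $\mathcal{CN}(0,1)$ entries; the cascaded channel of EU $\ell$ is $\mathbf g_\ell=\mathbf H_2\boldsymbol\Theta\sqrt{\beta_{RE,\ell}}\,\bar{\mathbf f}_\ell$ with $\beta_{RE,\ell}>0$, $\mathbf H_2=\sqrt{\beta/(\delta+1)}\,(\sqrt\delta\,\mathbf a\mathbf b^H+\tilde{\mathbf H}_2)$, $\beta>0$, $\delta\ge0$, where $\mathbf a\in\mathbb C^M$, $\mathbf b,\bar{\mathbf f}_\ell\in\mathbb C^N$ are deterministic vectors with unit-modulus entries, $\boldsymbol\Theta$ is a diagonal matrix with unit-modulus diagonal, and $\tilde{\mathbf H}_2$ has $\mathcal{CN}(0,1)$ entries. Put $\lambda_\ell=\beta_{RE,\ell}\beta/(\delta+1)$ and $\bar{\mathbf g}_\ell=\mathbb E\{\mathbf g_\ell\}=\sqrt{\lambda_\ell\delta}\,\mathbf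 a\mathbf b^H\boldsymbol\Theta\bar{\mathbf f}_\ell$. Training uses $\tau=\tau_I+\tau_E$ symbols and pilot power $p>0$. The pilots $\boldsymbol\varphi_1,\dots,\boldsymbol\varphi_{\tau_I},\bar{\boldsymbol\varphi}_1,\dots,\bar{\boldsymbol\varphi}_{\tau_E}\in\mathbb C^{\tau}$ are orthonormal; IU $k$ uses $\boldsymbol\varphi_{i_k}$ and EU $\ell$ uses $\bar{\boldsymbol\varphi}_{j_\ell}$. The BS receives $$\mathbf Y_p=\sqrt{\tau p}\sum_\ell\mathbf g_\ell\bar{\boldsymbol\varphi}_{j_\ell}^H+\sqrt{\tau p}\sum_k\mathbf h_k\boldsymbol\varphi_{i_k}^H+\mathbf N,$$ where $\mathbf N$ has $\mathcal{CN}(0,\sigma_n^2)$ entries, $\sigma_n^2>0$; all entries of all $\mathbf t_k$, $\tilde{\mathbf H}_2$ and $\mathbf N$ are independent. Let $\hat{\mathbf h}_k$ be the MMSE estimate of $\mathbf h_k$ from $\mathbf Y_p\boldsymbol\varphi_{i_k}$ and $$\gamma_k=\frac{\tau p\,\beta_{BI,k}^2}{\tau p\big(\sum_{k'}\beta_{BI,k'}|\boldsymbol\varphi_{i_{k'}}^H\boldsymbol\varphi_{i_k}|^2+\sum_\ell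 N\lambda_\ell|\bar{\boldsymbol\varphi}_{j_\ell}^H\boldsymbol\varphi_{i_k}|^2\big)+\sigma_n^2}.$$ Let $\hat{\mathbf g}_\ell$ be the estimate of $\mathbf g_\ell$, $$\hat{\mathbf g}_\ell=c_\ell\Big(\mathbf Y_p\bar{\boldsymbol\varphi}_{j_\ell}-\sqrt{\tau p}\sum_{\ell'}\bar{\mathbf g}_{\ell'}\bar{\boldsymbol\varphi}_{j_{\ell'}}^H\bar{\boldsymbol\varphi}_{j_\ell}\Big)+\bar{\mathbf g}_\ell,\qquad c_\ell=\frac{\sqrt{\tau p}\,N\lambda_\ell}{\tau p\big(\sum_{\ell'}N\lambda_{\ell'}|\bar{\boldsymbol\varphi}_{j_{\ell'}}^H\bar{\boldsymbol\varphi}_{j_\ell}|^2+\sum_{k}\beta_{BI,k}|\boldsymbol\varphi_{i_k}^H\bar{\boldsymbol\varphi}_{j_\ell}|^2\big)+\sigma_n^2},$$ or alternatively the MMSE estimate $\mathbf C_{gy}\mathbf C_{yy}^{-1}(\mathbf y-\mathbb E\{\mathbf y\})+\bar{\mathbf g}_\ell$ of $\mathbf g_\ell$ from $\mathbf y=\mathbf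 Y_p\bar{\boldsymbol\varphi}_{j_\ell}$, with the covariances of the model, provided that $\mathbb E\{\|\hat{\mathbf g}_\ell\|^2\}>0$ for all $\ell$. With $\hat{\mathbf H}_1=\mathbf Y_p[\boldsymbol\varphi_1,\dots,\boldsymbol\varphi_{\tau_I}]$, partial zero-forcing (PZF) uses the precoders $$\mathbf w_{I,k}=\frac{\hat{\mathbf H}_1(\hat{\mathbf H}_1^H\hat{\mathbf H}_1)^{-1}\mathbf e_{i_k}}{\sqrt{\mathbb E\{\|\hat{\mathbf H}_1(\hat{\mathbf H}_1^H\hat{\mathbf H}_1)^{-1}\mathbf e_{i_k}\|^2\}}},\qquad \mathbf w_{E,\ell}=\frac{\hat{\mathbf g}_\ell}{\sqrt{\mathbb E\{\|\hat{\mathbf g}_\ell\|^2\}}}.$$ For transmit powers $p_{I,k},p_{E,\ell}\ge0$ put $\rho_{I,k}=p_{I,k}/\sigma_n^2$, $\rho_{E,\ell}=p_{E,\ell}/\sigma_n^2$. With coherence intervals of $\tau_c\ge\tau$ symbols, the effective SINR and the achievable spectral efficiency of IU $k$ (hardening bound) are $$\mathrm{SINR}_k=\frac{\rho_{I,k}|\mathbb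 E\{\mathbf h_k^H\mathbf w_{I,k}\}|^2}{\sum_t\rho_{I,t}\mathbb E\{|\mathbf h_k^H\mathbf w_{I,t}|^2\}+\sum_\ell\rho_{E,\ell}\mathbb E\{|\mathbf h_k^H\mathbf w_{E,\ell}|^2\}-\rho_{I,k}|\mathbb E\{\mathbf h_k^H\mathbf w_{I,k}\}|^2+1},\qquad \mathrm{SE}_k=\Big(1-\frac{\tau}{\tau_c}\Big)\log_2(1+\mathrm{SINR}_k).$$ Suppose that $M>K_I$ and that no pilot is reused among the IUs, that is, each of $\boldsymbol\varphi_1,\dots,\boldsymbol\varphi_{\tau_I}$ is used by exactly one IU (so $\tau_I=K_I$); pilots may be reused among the EUs. Then, for every IU $k$, $\gamma_k=\mathbb E\{|[\hat{\mathbf h}_k]_m|^2\}$ for all $m$, the matrix $\hat{\mathbf H}_1^H\hat{\mathbf H}_1$ is almost surely invertible, all the precoders are well defined with $\mathbb E\{\|\mathbf w_{I,t}\|^2\}=\mathbb E\{\|\mathbf w_{E,\ell}\|^2\}=1$, all the gains $\mathbf h_k^H\mathbf w_{I,t}$ and $\mathbf h_k^H\mathbf w_{E,\ell}$ are square integrable,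 and $$\mathrm{SINR}_k=\frac{(M-K_I)\,\rho_{I,k}\,\gamma_k}{\sum_{t}\rho_{I,t}(\beta_{BI,k}-\gamma_k)+\sum_{\ell}\rho_{E,\ell}\,\beta_{BI,k}+1},$$ so that $\mathrm{SE}_k=(1-\tau/\tau_c)\log_2(1+\mathrm{SINR}_k)$ with this value. -/

import Mathlib

open MeasureTheory ProbabilityTheory
open scoped Matrix ComplexConjugate

noncomputable section

namespace SWIPT

/-- The circularly symmetric complex Gaussian law `CN(0, v)`: independent real and imaginary
parts, each centred with variance `v / 2`. -/
def complexGaussian (v : ℝ) : Measure ℂ :=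
  ((gaussianReal 0 (v / 2).toNNReal).prod (gaussianReal 0 (v / 2).toNNReal)).map
    (fun z : ℝ × ℝ => (⟨z.1, z.2⟩ : ℂ))

/-- Squared Euclidean norm of a complex vector. -/
def sqNorm {M : ℕ} (v : Fin M → ℂ) : ℝ := ∑ m, ‖v m‖ ^ 2

/-- Mean of a random vector. -/
def mean {M : ℕ} {Ω : Type*} [MeasurableSpace Ω] (P : Measure Ω) (X : Ω → Fin M → ℂ) :
    Fin M → ℂ := fun i => ∫ ω, X ω i ∂P

/-- Cross-covariance matrix `E{X Yᴴ} - E{X} E{Y}ᴴ` of two random vectors. -/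
def crossCov {M : ℕ} {Ω : Type*} [MeasurableSpace Ω] (P : Measure Ω) (X Y : Ω → Fin M → ℂ) :
    Matrix (Fin M) (Fin M) ℂ :=
  Matrix.of fun i j => (∫ ω, X ω i * conj (Y ω j) ∂P) - mean P X i * conj (mean P Y j)

/-- MMSE estimate `C_XY C_YY⁻¹ (Y - E{Y}) + E{X}` of `X` from the observation `Y`. -/
def mmse {M : ℕ} {Ω : Type*} [MeasurableSpace Ω] (P : Measure Ω) (X Y : Ω → Fin M → ℂ)
    (ω : Ω) : Fin M → ℂ :=
  (crossCov P X Y * (crossCov P Y Y)⁻¹) *ᵥ (Y ω - mean P Y) + mean P X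

/-- Deterministic data of the system: `M` antennas at the base station, `N` elements of the
reflecting surface, `KI` information users, `KE` energy users, `τI` pilots for the information
users and `τE` pilots for the energy users; pilots have length `τ = τI + τE`. -/
structure Params (M N KI KE τI τE : ℕ) where
  /-- large-scale fading coefficients of the information users -/
  βBI : Fin KI → ℝ
  βBI_pos : ∀ k, 0 < βBI k
  /-- path loss from the base station to the reflecting surface -/
  β : ℝ
  β_pos : 0 < β
  /-- path losses from the reflecting surface to the energy users -/
  βRE : Fin KE → ℝ
  βRE_pos : ∀ l, 0 < βRE l
  /-- Ricean factor -/
  δ : ℝ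
  δ_nonneg : 0 ≤ δ
  N_pos : 0 < N
  /-- phase shifts of the reflecting surface -/
  ψ : Fin N → ℝ
  /-- phases of the entries of the array response of the base station -/
  phaseBS : Fin M → ℝ
  /-- phases of the entries of the array response of the surface, towards the base station -/
  phaseRIS : Fin N → ℝ
  /-- phases of the entries of the array responses of the surface, towards the energy users -/
  phaseEU : Fin KE → Fin N → ℝ
  /-- pilot transmission power -/
  p : ℝ
  p_pos : 0 < p
  /-- noise power -/
  σ2 : ℝ
  σ2_pos : 0 < σ2
  /-- pilot book of the information users -/
  φI : Fin τI → Fin (τI + τE) → ℂ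
  /-- pilot book of the energy users -/
  φE : Fin τE → Fin (τI + τE) → ℂ
  φI_orthonormal : ∀ i j, star (φI i) ⬝ᵥ φI j = if i = j then 1 else 0
  φE_orthonormal : ∀ i j, star (φE i) ⬝ᵥ φE j = if i = j then 1 else 0
  φI_orth_φE : ∀ i j, star (φI i) ⬝ᵥ φE j = 0
  /-- index of the pilot of each information user -/
  iI : Fin KI → Fin τI
  /-- index of the pilot of each energy user -/
  iE : Fin KE → Fin τE
  /-- downlink transmit powers for the information users -/
  pI : Fin KI → ℝ
  pI_nonneg : ∀ k, 0 ≤ pI k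
  /-- downlink transmit powers for the energy users -/
  pE : Fin KE → ℝ
  pE_nonneg : ∀ l, 0 ≤ pE l
  /-- length of a coherence interval -/
  τc : ℕ
  τ_le_τc : τI + τE ≤ τc

/-- The random matrices of the system: small-scale fading of the information users,
scattered component of the channel to the reflecting surface, pilot noise. -/
structure Fading (M N KI τ : ℕ) (Ω : Type*) where
  H1t : Ω → Matrix (Fin M) (Fin KI) ℂ
  H2t : Ω → Matrix (Fin M) (Fin N) ℂ
  noise : Ω → Matrix (Fin M) (Fin τ) ℂ

/-- All entries of the random matrices of the system, as one family. -/
def Fading.entry {M N KI τ : ℕ} {Ω : Type*} (F : Fading M N KI τ Ω) :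
    (Fin M × Fin KI) ⊕ (Fin M × Fin N) ⊕ (Fin M × Fin τ) → Ω → ℂ
  | .inl (m, k) => fun ω => F.H1t ω m k
  | .inr (.inl (m, n)) => fun ω => F.H2t ω m n
  | .inr (.inr (m, s)) => fun ω => F.noise ω m s

namespace Params

variable {M N KI KE τI τE : ℕ} (S : Params M N KI KE τI τE)

/-- The fading entries are `CN(0, 1)`, the noise entries are `CN(0, σ²)`, and all of them are
mutually independent. -/
structure IsGaussian {Ω : Type*} [MeasurableSpace Ω] (P : Measure Ω)
    (F : Fading M N KI (τI + τE) Ω) : Prop where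
  law_H1t : ∀ m k, HasLaw (fun ω => F.H1t ω m k) (complexGaussian 1) P
  law_H2t : ∀ m n, HasLaw (fun ω => F.H2t ω m n) (complexGaussian 1) P
  law_noise : ∀ m s, HasLaw (fun ω => F.noise ω m s) (complexGaussian S.σ2) P
  indep : iIndepFun F.entry P

/-- Vector with unit-modulus entries of the given phases. -/
def phaseVec {n : ℕ} (a : Fin n → ℝ) : Fin n → ℂ := fun i => Complex.exp (a i * Complex.I)

/-- Phase shift matrix of the reflecting surface. -/
def Θ : Matrix (Fin N) (Fin N) ℂ := Matrix.diagonal (phaseVec S.ψ)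

/-- Line-of-sight component of the channel from the base station to the surface. -/
def H2bar : Matrix (Fin M) (Fin N) ℂ :=
  Matrix.vecMulVec (phaseVec S.phaseBS) (star (phaseVec S.phaseRIS))

/-- Line-of-sight channel from the surface to energy user `l`. -/
def fbar (l : Fin KE) : Fin N → ℂ := phaseVec (S.phaseEU l)

/-- `λ_l`, the path loss of the cascaded channel of energy user `l`. -/
def lam (l : Fin KE) : ℝ := S.βRE l * S.β / (S.δ + 1)

/-- SNR of the information symbols. -/
def ρI (k : Fin KI) : ℝ := S.pI k / S.σ2

/-- SNR of the energy symbols. -/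
def ρE (l : Fin KE) : ℝ := S.pE l / S.σ2

/-- `τ p`, the pilot energy. -/
def pilotEnergy : ℝ := ((τI + τE : ℕ) : ℝ) * S.p

/-- Pilot of information user `k`. -/
def pilotI (k : Fin KI) : Fin (τI + τE) → ℂ := S.φI (S.iI k)

/-- Pilot of energy user `l`. -/
def pilotE (l : Fin KE) : Fin (τI + τE) → ℂ := S.φE (S.iE l)

/-- The coefficient `c_{h_k}` of the channel estimate of information user `k`. -/
def cH (k : Fin KI) : ℝ :=
  √S.pilotEnergy * S.βBI k /
    (S.pilotEnergy *
        (∑ k', S.βBI k' * ‖star (S.pilotI k') ⬝ᵥ S.pilotI k‖ ^ 2 +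
          ∑ l, N * S.lam l * ‖star (S.pilotE l) ⬝ᵥ S.pilotI k‖ ^ 2) + S.σ2)

/-- The coefficient `c_{g_l}` of the channel estimate of energy user `l`. -/
def cG (l : Fin KE) : ℝ :=
  √S.pilotEnergy * (N * S.lam l) /
    (S.pilotEnergy *
        (∑ l', N * S.lam l' * ‖star (S.pilotE l') ⬝ᵥ S.pilotE l‖ ^ 2 +
          ∑ k, S.βBI k * ‖star (S.pilotI k) ⬝ᵥ S.pilotE l‖ ^ 2) + S.σ2)

/-- `γ_k = √(τ p) β_{BI,k} c_{h_k}`, the mean square of the entries of the channel estimate. -/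
def γ (k : Fin KI) : ℝ := √S.pilotEnergy * S.βBI k * S.cH k

/-- Mean of the cascaded channel of energy user `l`. -/
def gMean (l : Fin KE) : Fin M → ℂ :=
  (√(S.lam l * S.δ) : ℂ) • (S.H2bar *ᵥ (S.Θ *ᵥ S.fbar l))

section Random

variable {Ω : Type*} [MeasurableSpace Ω] (P : Measure Ω) (F : Fading M N KI (τI + τE) Ω)

/-- Channel of information user `k`. -/
def h (k : Fin KI) (ω : Ω) : Fin M → ℂ := fun m => (√(S.βBI k) : ℂ) * F.H1t ω m k

/-- Ricean channel from the base station to the surface. -/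
def H2 (ω : Ω) : Matrix (Fin M) (Fin N) ℂ :=
  (√(S.β / (S.δ + 1)) : ℂ) • ((√S.δ : ℂ) • S.H2bar + F.H2t ω)

/-- Cascaded channel `H₂ Θ (√β_{RE,l} f̄_l)` of energy user `l`. -/
def g (l : Fin KE) (ω : Ω) : Fin M → ℂ :=
  S.H2 F ω *ᵥ (S.Θ *ᵥ ((√(S.βRE l) : ℂ) • S.fbar l))

/-- Received pilot matrix `Y_p`. -/
def Yp (ω : Ω) : Matrix (Fin M) (Fin (τI + τE)) ℂ :=
  (√S.pilotEnergy : ℂ) • ∑ l, Matrix.vecMulVec (S.g F l ω) (star (S.pilotE l)) +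
    (√S.pilotEnergy : ℂ) • ∑ k, Matrix.vecMulVec (S.h F k ω) (star (S.pilotI k)) + F.noise ω

/-- Observation `Y_p φ` of the channel of information user `k`. -/
def yI (k : Fin KI) (ω : Ω) : Fin M → ℂ := S.Yp F ω *ᵥ S.pilotI k

/-- Observation `Y_p φ̄` of the channel of energy user `l`. -/
def yE (l : Fin KE) (ω : Ω) : Fin M → ℂ := S.Yp F ω *ᵥ S.pilotE l

/-- MMSE estimate of the channel of information user `k`. -/
def hHat (k : Fin KI) : Ω → Fin M → ℂ := mmse P (S.h F k) (S.yI F k)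

/-- Estimate of the cascaded channel of energy user `l`, in the explicit form with the
coefficient `c_{g_l}`. -/
def gHat (l : Fin KE) (ω : Ω) : Fin M → ℂ :=
  (S.cG l : ℂ) •
      (S.yE F l ω -
        (√S.pilotEnergy : ℂ) • ∑ l', (star (S.pilotE l') ⬝ᵥ S.pilotE l) • S.gMean l') +
    S.gMean l

/-- MMSE estimate of the cascaded channel of energy user `l`, through the covariances. -/
def gHatMMSE (l : Fin KE) : Ω → Fin M → ℂ := mmse P (S.g F l) (S.yE F l)

/-- `Ĥ₁ = Y_p Φ_I`. -/
def H1hat (ω : Ω) : Matrix (Fin M) (Fin τI) ℂ :=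
  S.Yp F ω * Matrix.of fun s i => S.φI i s

/-- Unnormalized zero-forcing vector `Ĥ₁ (Ĥ₁ᴴ Ĥ₁)⁻¹ e_{i_k}`. -/
def zfDir (k : Fin KI) (ω : Ω) : Fin M → ℂ :=
  (S.H1hat F ω * ((S.H1hat F ω)ᴴ * S.H1hat F ω)⁻¹) *ᵥ Pi.single (S.iI k) 1

end Random

end Params

/-- Normalization `v / √E{‖v‖²}` of a random vector to unit mean power. -/
def normalize {M : ℕ} {Ω : Type*} [MeasurableSpace Ω] (P : Measure Ω) (v : Ω → Fin M → ℂ)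
    (ω : Ω) : Fin M → ℂ :=
  ((1 / √(∫ ω', sqNorm (v ω') ∂P) : ℝ) : ℂ) • v ω

namespace Params

variable {M N KI KE τI τE : ℕ} (S : Params M N KI KE τI τE)
variable {Ω : Type*} [MeasurableSpace Ω] (P : Measure Ω) (F : Fading M N KI (τI + τE) Ω)

/-- PZF precoding vector of information user `k`. -/
def wPZF (k : Fin KI) : Ω → Fin M → ℂ := normalize P (S.zfDir F k)

/-- Effective gain `h_kᴴ w` of information user `k` for a precoding vector `w`. -/
def gain (k : Fin KI) (w : Ω → Fin M → ℂ) (ω : Ω) : ℂ := star (S.h F k ω) ⬝ᵥ w ω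

/-- Effective SINR of information user `k` for precoding vectors `wI` and `wE`: power of the
mean gain against the power of the effective noise (gain uncertainty, interference from all
users, and normalized thermal noise). -/
def sinr (wI : Fin KI → Ω → Fin M → ℂ) (wE : Fin KE → Ω → Fin M → ℂ) (k : Fin KI) : ℝ :=
  S.ρI k * ‖∫ ω, S.gain F k (wI k) ω ∂P‖ ^ 2 /
    (∑ t, S.ρI t * (∫ ω, ‖S.gain F k (wI t) ω‖ ^ 2 ∂P) +
      ∑ l, S.ρE l * (∫ ω, ‖S.gain F k (wE l) ω‖ ^ 2 ∂P) -
      S.ρI k * ‖∫ ω, S.gain F k (wI k) ω ∂P‖ ^ 2 + 1)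

/-- Achievable downlink spectral efficiency of information user `k` (bit/s/Hz). -/
def spectralEff (wI : Fin KI → Ω → Fin M → ℂ) (wE : Fin KE → Ω → Fin M → ℂ) (k : Fin KI) : ℝ :=
  (1 - ((τI + τE : ℕ) : ℝ) / S.τc) * Real.logb 2 (1 + S.sinr P F wI wE k)

end Params

end SWIPT

end

-- Without pilot reuse, the fading of information user `t` is seen only through its own pilot, as
-- `√obsVar (cos · fading + sin · noise)`, where `cos²` and `sin²` are the shares of the channel and
-- of the noise in the observed power. The matrix `rotation` sends fading and normalized noise to
-- the normalized observations `U_j` of all users and the normalized error `U₀` of user `k`. Its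
-- rows are orthonormal, so these vectors are again independent with `CN(0, 1)` entries
-- (`stdGaussianVec_map_mulVec`, `hasLaw_whitened`), and `h_k = √β (cos · U_k + sin · U₀)` with `γ =
-- β cos²`.
--
-- The zero-forcing precoders depend on the `U_j` alone, hence are independent of `U₀`. Zero-forcing
-- makes the part of `h_k` along `U_k` contribute a constant to the gain when `t = k` and nothing
-- otherwise; the rest is `√β sin · U₀ᴴ w_t`, centred with second moment `β sin² = β - γ`
-- (`ae_gain_wPZF`).
--
-- The constant comes from the mean power of the unnormalized direction. Its squared norm is the
-- inverse squared distance of one Gaussian column to the span of the others (`sqNorm_zfVec_mul`),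
-- that is, the inverse squared norm of a standard Gaussian vector of dimension `M - K + 1`, with
-- mean `1 / (M - K)` (`lintegral_inv_sqNorm`). So the squared mean gain is `(M - K) γ`.
--
-- The pilots of the energy users are orthogonal to those of the information users, so any estimate
-- affine in `yE` is independent of `h_k`, and a unit-power precoder built from it has gain of mean
-- square `β`.

noncomputable section

namespace SWIPT

-- Complex Gaussian laws: characteristic functions and unitary invariance.

instance (v : ℝ) : IsProbabilityMeasure (complexGaussian v) := by
  unfold complexGaussian
  exact Measure.isProbabilityMeasure_map Complex.measurableEquivRealProd.symm.measurable.aemeasurable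

lemma measurable_complex_mk : Measurable (fun z : ℝ × ℝ => (⟨z.1, z.2⟩ : ℂ)) :=
  Complex.measurableEquivRealProd.symm.measurable

/-- Characteristic function of `CN(0, v)`. -/
lemma charFunDual_complexGaussian {v : ℝ} (hv : 0 ≤ v) (L : StrongDual ℝ ℂ) :
    charFunDual (complexGaussian v) L =
      Complex.exp (-(v / 4 * (L 1 ^ 2 + L Complex.I ^ 2) : ℝ)) := by
  have hL : ∀ z : ℝ × ℝ, L (⟨z.1, z.2⟩ : ℂ) = z.1 * L 1 + z.2 * L Complex.I := by
    intro z
    have : (⟨z.1, z.2⟩ : ℂ) = z.1 • (1 : ℂ) + z.2 • Complex.I := by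
      apply Complex.ext <;> simp
    rw [this, map_add, map_smul, map_smul, smul_eq_mul, smul_eq_mul]
  rw [charFunDual_apply, complexGaussian,
    integral_map measurable_complex_mk.aemeasurable (by fun_prop)]
  have : ∀ z : ℝ × ℝ, Complex.exp ((L (⟨z.1, z.2⟩ : ℂ) : ℂ) * Complex.I) =
      Complex.exp ((L 1 : ℝ) * z.1 * Complex.I) *
        Complex.exp ((L Complex.I : ℝ) * z.2 * Complex.I) := by
    intro z
    rw [← Complex.exp_add, hL]
    push_cast
    ring_nf
  simp_rw [this]
  rw [integral_prod_mul (fun x : ℝ => Complex.exp ((L 1 : ℝ) * x * Complex.I))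
    (fun x : ℝ => Complex.exp ((L Complex.I : ℝ) * x * Complex.I)), ← charFun_apply_real,
    ← charFun_apply_real, charFun_gaussianReal, charFun_gaussianReal, ← Complex.exp_add]
  congr 1
  have : ((v / 2).toNNReal : ℂ) = (v / 2 : ℝ) := by
    rw [← Real.coe_toNNReal (v / 2) (by positivity)]; simp
  rw [this]
  push_cast
  ring

/-- With `c = -1` this is the symmetry behind the zero mean; otherwise it rescales the noise to unit
variance and the fading to the channel. -/
lemma complexGaussian_map_smul {v : ℝ} (hv : 0 ≤ v) (c : ℝ) :
    (complexGaussian v).map (fun z => (c : ℂ) * z) = complexGaussian (c ^ 2 * v) := by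
  have h1 : (fun z : ℂ => (c : ℂ) * z) = ⇑(c • ContinuousLinearMap.id ℝ ℂ) := by
    ext z; simp
  have : IsProbabilityMeasure ((complexGaussian v).map (fun z => (c : ℂ) * z)) :=
    Measure.isProbabilityMeasure_map (by fun_prop)
  refine Measure.ext_of_charFunDual (funext fun L => ?_)
  rw [h1, charFunDual_map, charFunDual_complexGaussian hv,
    charFunDual_complexGaussian (by positivity)]
  congr 2
  norm_cast
  simp
  ring

/-- The law of a vector of independent `CN(0, 1)` entries. -/
def stdGaussianVec (ι : Type*) [Fintype ι] : Measure (ι → ℂ) :=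
  Measure.pi fun _ => complexGaussian 1

instance (ι : Type*) [Fintype ι] : IsProbabilityMeasure (stdGaussianVec ι) := by
  unfold stdGaussianVec; infer_instance

/-- Invariance of the standard complex Gaussian law under matrices with orthonormal rows. -/
lemma stdGaussianVec_map_mulVec {ι κ : Type*} [Fintype ι] [Fintype κ] [DecidableEq κ]
    (B : Matrix κ ι ℂ) (hB : B * Bᴴ = 1) :
    (stdGaussianVec ι).map (fun z => B *ᵥ z) = stdGaussianVec κ := by
  classical
  let T : (ι → ℂ) →L[ℝ] (κ → ℂ) :=
    (LinearMap.toContinuousLinearMap (Matrix.mulVecLin B)).restrictScalars ℝ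
  have hT : (fun z => B *ᵥ z) = ⇑T := by ext z; simp [T]
  have hm : Measurable (fun z : ι → ℂ => B *ᵥ z) := by rw [hT]; exact T.measurable
  have : IsProbabilityMeasure ((stdGaussianVec ι).map (fun z => B *ᵥ z)) :=
    Measure.isProbabilityMeasure_map hm.aemeasurable
  unfold stdGaussianVec at *
  rw [← charFunDual_eq_pi_iff]
  intro L
  rw [hT, charFunDual_map, charFunDual_pi]
  simp_rw [charFunDual_complexGaussian zero_le_one]
  rw [← Complex.exp_sum, ← Complex.exp_sum]
  congr 1
  rw [Finset.sum_neg_distrib, Finset.sum_neg_distrib, ← Complex.ofReal_sum, ← Complex.ofReal_sum,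
    ← Finset.mul_sum, ← Finset.mul_sum]
  congr 3
  -- The vector `w` represents `L` as `v ↦ Re (wᴴ v)`. The characteristic function sees only `‖w‖²`,
  -- and composing with `B` replaces `w` by `Bᴴ w`, of the same norm because `B Bᴴ = 1`.
  set w : κ → ℂ := fun k => ⟨L (Pi.single k 1), L (Pi.single k Complex.I)⟩ with hw
  have hL : ∀ v : κ → ℂ, L v = (star w ⬝ᵥ v).re := by
    intro v
    have hv : v = ∑ k, ((v k).re • (Pi.single k (1 : ℂ) : κ → ℂ) +
        (v k).im • (Pi.single k Complex.I : κ → ℂ)) := by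
      ext j
      rw [Finset.sum_apply, Finset.sum_eq_single j]
      · apply Complex.ext <;> simp
      · intro b _ hb; simp [hb.symm]
      · simp
    conv_lhs => rw [hv]
    simp [dotProduct, hw]
    refine Finset.sum_congr rfl fun k _ => by ring
  have h1 : ∀ i, (L.comp T).comp (.single ℝ (fun _ => ℂ) i) 1 = (star w ⬝ᵥ B.col i).re := by
    intro i
    simp [hL, T, Matrix.mulVec_single]
  have h2 : ∀ i, (L.comp T).comp (.single ℝ (fun _ => ℂ) i) Complex.I =
      -(star w ⬝ᵥ B.col i).im := by
    intro i
    simp [hL, T, Matrix.mulVec_single]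
  have h3 : ∀ k, L.comp (.single ℝ (fun _ => ℂ) k) 1 = (w k).re := by intro k; simp [hw]
  have h4 : ∀ k, L.comp (.single ℝ (fun _ => ℂ) k) Complex.I = (w k).im := by intro k; simp [hw]
  simp_rw [h1, h2, h3, h4]
  have hn : ∀ z : ℂ, ((z.re ^ 2 + z.im ^ 2 : ℝ) : ℂ) = z * star z := by
    intro z
    rw [Complex.star_def, Complex.mul_conj, Complex.normSq_apply]; push_cast; ring
  have hn' : ∀ z : ℂ, ((z.re ^ 2 + (-z.im) ^ 2 : ℝ) : ℂ) = z * star z := by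
    intro z
    rw [← hn]; congr 1; ring
  have : ((∑ i, ((star w ⬝ᵥ B.col i).re ^ 2 + (-(star w ⬝ᵥ B.col i).im) ^ 2) : ℝ) : ℂ) =
      ((∑ i, ((w i).re ^ 2 + (w i).im ^ 2) : ℝ) : ℂ) := by
    rw [Complex.ofReal_sum, Complex.ofReal_sum]
    simp_rw [hn, hn']
    have e1 : ∑ i, (star w ⬝ᵥ B.col i) * star (star w ⬝ᵥ B.col i) =
        (star w ᵥ* B) ⬝ᵥ star (star w ᵥ* B) := rfl
    have e2 : ∑ i, w i * star (w i) = star w ⬝ᵥ w := by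
      simp [dotProduct, mul_comm]
    rw [e1, e2, Matrix.star_vecMul, star_star, ← Matrix.dotProduct_mulVec, Matrix.mulVec_mulVec, hB,
      Matrix.one_mulVec]
  exact_mod_cast this

-- Mean inverse squared norm of a Gaussian vector, by Laplace transform.

lemma integral_exp_neg_mul_sq_gaussianReal_half {u : ℝ} (hu : 0 ≤ u) :
    ∫ x, Real.exp (-u * x ^ 2) ∂(gaussianReal 0 (1 / 2 : ℝ).toNNReal) = (√(1 + u))⁻¹ := by
  have hv : (1 / 2 : ℝ).toNNReal ≠ 0 := by simp
  rw [integral_gaussianReal_eq_integral_smul hv]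
  have : ∀ x : ℝ, gaussianPDFReal 0 (1 / 2 : ℝ).toNNReal x • Real.exp (-u * x ^ 2) =
      (√Real.pi)⁻¹ * Real.exp (-(1 + u) * x ^ 2) := by
    intro x
    rw [gaussianPDFReal, smul_eq_mul, mul_assoc, ← Real.exp_add,
      Real.coe_toNNReal _ (by norm_num)]
    congr 2
    · rw [show 2 * Real.pi * (1 / 2) = Real.pi by ring]
    · ring
  simp_rw [this]
  rw [integral_const_mul, integral_gaussian, Real.sqrt_div Real.pi_pos.le]
  have := Real.sqrt_pos.2 Real.pi_pos
  field_simp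

lemma integral_exp_neg_mul_sq_complexGaussian {u : ℝ} (hu : 0 ≤ u) :
    ∫ z, Real.exp (-u * ‖z‖ ^ 2) ∂(complexGaussian 1) = (1 + u)⁻¹ := by
  rw [complexGaussian, integral_map measurable_complex_mk.aemeasurable (by fun_prop)]
  have : ∀ z : ℝ × ℝ, Real.exp (-u * ‖(⟨z.1, z.2⟩ : ℂ)‖ ^ 2) =
      Real.exp (-u * z.1 ^ 2) * Real.exp (-u * z.2 ^ 2) := by
    intro z
    rw [← Real.exp_add, ← Complex.normSq_eq_norm_sq, Complex.normSq_apply]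
    congr 1; ring
  simp_rw [this]
  rw [integral_prod_mul (fun x : ℝ => Real.exp (-u * x ^ 2)) (fun x : ℝ => Real.exp (-u * x ^ 2)),
    integral_exp_neg_mul_sq_gaussianReal_half hu, ← mul_inv, Real.mul_self_sqrt (by positivity)]

lemma lintegral_exp_neg_mul_sqNorm {n : ℕ} {u : ℝ} (hu : 0 ≤ u) :
    ∫⁻ z, ENNReal.ofReal (Real.exp (-u * sqNorm z)) ∂(stdGaussianVec (Fin n)) =
      ENNReal.ofReal (((1 + u) ^ n)⁻¹) := by
  have hm : Measurable (fun z : Fin n → ℂ => Real.exp (-u * sqNorm z)) := by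
    unfold sqNorm; fun_prop
  rw [← ofReal_integral_eq_lintegral_ofReal]
  · congr 1
    have : ∀ z : Fin n → ℂ, Real.exp (-u * sqNorm z) = ∏ i, Real.exp (-u * ‖z i‖ ^ 2) := by
      intro z
      rw [← Real.exp_sum, sqNorm, Finset.mul_sum]
    simp_rw [this]
    rw [stdGaussianVec, integral_fintype_prod_eq_pow (fun z : ℂ => Real.exp (-u * ‖z‖ ^ 2)),
      integral_exp_neg_mul_sq_complexGaussian hu]
    simp
  · refine Integrable.of_bound hm.aestronglyMeasurable 1 (ae_of_all _ fun z => ?_)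
    rw [Real.norm_eq_abs, Real.abs_exp, Real.exp_le_one_iff]
    have : 0 ≤ sqNorm z := by unfold sqNorm; positivity
    nlinarith
  · exact ae_of_all _ fun z => (Real.exp_pos _).le

/-- Represents `1 / s` as a superposition of exponentials, whose Gaussian means factor over
coordinates. In extended reals it also covers `s = 0`, where both sides are infinite. -/
lemma lintegral_exp_neg_mul_Ioi {s : ℝ} (hs : 0 ≤ s) :
    ∫⁻ u in Set.Ioi (0 : ℝ), ENNReal.ofReal (Real.exp (-u * s)) = (ENNReal.ofReal s)⁻¹ := by
  rcases hs.eq_or_lt with rfl | hs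
  · simp
  · have h := integrableOn_exp_mul_Ioi (a := -s) (by linarith) 0
    rw [← ENNReal.ofReal_inv_of_pos hs]
    have e : ∀ u : ℝ, Real.exp (-u * s) = Real.exp (-s * u) := fun u => by ring_nf
    simp_rw [e]
    rw [← ofReal_integral_eq_lintegral_ofReal h (ae_of_all _ fun z => (Real.exp_pos _).le),
      integral_exp_mul_Ioi (by linarith)]
    simp [neg_div_neg_eq]

/-- The exponent starts at 2 because `1 / (1 + u)` is not integrable at infinity; this is the source
of the condition `K < M` on the zero-forcing power. -/
lemma lintegral_inv_one_add_pow (m : ℕ) :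
    ∫⁻ u in Set.Ioi (0 : ℝ), ENNReal.ofReal (((1 + u) ^ (m + 2))⁻¹) =
      ENNReal.ofReal ((m + 1 : ℝ)⁻¹) := by
  have hd : ∀ x ∈ Set.Ici (0 : ℝ), HasDerivAt
      (fun u : ℝ => -((m + 1 : ℝ)⁻¹ * ((1 + u) ^ (m + 1))⁻¹))
      (((1 + x) ^ (m + 2))⁻¹) x := by
    intro x hx
    have hx' : (1 + x) ≠ 0 := by have : (0 : ℝ) ≤ x := hx; positivity
    have h := ((((hasDerivAt_id x).const_add 1).pow (m + 1)).inv
      (by simpa using pow_ne_zero (m + 1) hx')).const_mul ((m + 1 : ℝ)⁻¹) |>.neg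
    convert! h using 1
    simp
    field_simp
    ring
  have ht : Filter.Tendsto (fun u : ℝ => -((m + 1 : ℝ)⁻¹ * ((1 + u) ^ (m + 1))⁻¹)) Filter.atTop
      (nhds 0) := by
    have : Filter.Tendsto (fun u : ℝ => (1 + u) ^ (m + 1)) Filter.atTop Filter.atTop :=
      (Filter.tendsto_pow_atTop (by omega)).comp (Filter.tendsto_atTop_add_const_left _ _ Filter.tendsto_id)
    simpa using (this.inv_tendsto_atTop.const_mul ((m + 1 : ℝ)⁻¹)).neg
  have hpos : ∀ x ∈ Set.Ioi (0 : ℝ), 0 ≤ ((1 + x) ^ (m + 2))⁻¹ := by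
    intro x hx
    have : (0 : ℝ) < x := hx
    positivity
  rw [← ofReal_integral_eq_lintegral_ofReal (integrableOn_Ioi_deriv_of_nonneg' hd hpos ht)
    (ae_restrict_of_forall_mem measurableSet_Ioi hpos),
    integral_Ioi_of_hasDerivAt_of_nonneg' hd hpos ht]
  simp

/-- Mean of the inverse squared norm of a standard complex Gaussian vector. -/
lemma lintegral_inv_sqNorm {n : ℕ} (hn : 2 ≤ n) :
    ∫⁻ z, (ENNReal.ofReal (sqNorm z))⁻¹ ∂(stdGaussianVec (Fin n)) =
      ENNReal.ofReal ((n - 1 : ℝ)⁻¹) := by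
  obtain ⟨m, rfl⟩ := Nat.exists_eq_add_of_le' hn
  have hnn : ∀ z : Fin (m + 2) → ℂ, 0 ≤ sqNorm z := fun z => by unfold sqNorm; positivity
  simp_rw [← fun z => lintegral_exp_neg_mul_Ioi (hnn z)]
  -- Tonelli: after the exchange the inner integral is the Laplace transform `(1 + u)⁻ⁿ` of the
  -- squared norm.
  rw [lintegral_lintegral_swap]
  · rw [setLIntegral_congr_fun measurableSet_Ioi
      (fun u hu => lintegral_exp_neg_mul_sqNorm (le_of_lt hu)), lintegral_inv_one_add_pow]
    congr 2; push_cast; ring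
  · unfold sqNorm; fun_prop

-- First and second moments of `CN(0, v)`.

lemma memLp_id_complexGaussian (v : ℝ) : MemLp (fun z : ℂ => z) 2 (complexGaussian v) := by
  rw [complexGaussian, memLp_map_measure_iff (by fun_prop) measurable_complex_mk.aemeasurable]
  have h1 := (memLp_id_gaussianReal' (μ := 0) (v := (v / 2).toNNReal) 2 (by simp)).comp_fst
    (gaussianReal 0 (v / 2).toNNReal)
  have h2 := (memLp_id_gaussianReal' (μ := 0) (v := (v / 2).toNNReal) 2 (by simp)).comp_snd
    (gaussianReal 0 (v / 2).toNNReal)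
  have h3 := (h1.ofReal (K := ℂ)).add ((h2.ofReal (K := ℂ)).const_mul Complex.I)
  refine h3.congr_norm (measurable_complex_mk.aestronglyMeasurable) (ae_of_all _ fun z => ?_)
  congr 1
  apply Complex.ext <;> simp

lemma integral_id_complexGaussian {v : ℝ} (hv : 0 ≤ v) : ∫ z, z ∂(complexGaussian v) = 0 := by
  have h := complexGaussian_map_smul hv (-1)
  have : ∫ z, z ∂(complexGaussian v) = -∫ z, z ∂(complexGaussian v) := by
    conv_lhs => rw [← one_mul v, ← neg_one_sq, ← h, integral_map (by fun_prop) (by fun_prop)]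
    rw [← integral_neg]
    simp
  exact self_eq_neg.mp this

lemma integral_norm_sq_complexGaussian {v : ℝ} (hv : 0 ≤ v) :
    ∫ z, ‖z‖ ^ 2 ∂(complexGaussian v) = v := by
  rw [complexGaussian, integral_map measurable_complex_mk.aemeasurable (by fun_prop)]
  have : ∀ z : ℝ × ℝ, ‖(⟨z.1, z.2⟩ : ℂ)‖ ^ 2 = z.1 ^ 2 + z.2 ^ 2 := by
    intro z
    rw [← Complex.normSq_eq_norm_sq, Complex.normSq_apply]
    ring
  simp_rw [this]
  have hm := memLp_id_gaussianReal' (μ := 0) (v := (v / 2).toNNReal) 2 (by simp)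
  have hs : ∫ x, x ^ 2 ∂(gaussianReal 0 (v / 2).toNNReal) = v / 2 := by
    have := variance_fun_id_gaussianReal (μ := 0) (v := (v / 2).toNNReal)
    rw [variance_of_integral_eq_zero (by fun_prop) (by simp)] at this
    rw [this, Real.coe_toNNReal _ (by positivity)]
  rw [integral_add, integral_fun_fst (fun x : ℝ => x ^ 2), integral_fun_snd (fun x : ℝ => x ^ 2), hs]
  · simp
  · exact (hm.comp_fst _).integrable_sq
  · exact (hm.comp_snd _).integrable_sq


-- Linear algebra of zero-forcing directions.

/-- Zero-forcing direction `H (Hᴴ H)⁻¹ e_i` of the channel matrix `H`. -/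
def zfVec {M : ℕ} {ι : Type*} [Fintype ι] [DecidableEq ι] (H : Matrix (Fin M) ι ℂ) (i : ι) :
    Fin M → ℂ :=
  (H * (Hᴴ * H)⁻¹) *ᵥ Pi.single i 1

lemma sqNorm_nonneg {M : ℕ} (v : Fin M → ℂ) : 0 ≤ sqNorm v := by unfold sqNorm; positivity

lemma star_dotProduct_self {M : ℕ} (v : Fin M → ℂ) : star v ⬝ᵥ v = (sqNorm v : ℂ) := by
  simp [dotProduct, sqNorm, Complex.conj_mul']

lemma sqNorm_smul {M : ℕ} (c : ℂ) (v : Fin M → ℂ) : sqNorm (c • v) = ‖c‖ ^ 2 * sqNorm v := by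
  simp [sqNorm, mul_pow, Finset.mul_sum]

/-- Since `aᴴ Hᴴ H a = ‖H a‖²`, the Gram matrix and `H` have the same kernel. -/
lemma isUnit_gram_iff {M : ℕ} {ι : Type*} [Fintype ι] [DecidableEq ι] (H : Matrix (Fin M) ι ℂ) :
    IsUnit (Hᴴ * H) ↔ LinearIndependent ℂ H.col := by
  rw [← Matrix.mulVec_injective_iff, ← Matrix.mulVec_injective_iff_isUnit]
  open scoped ComplexOrder in
  have h : ∀ a, Matrix.mulVecLin (Hᴴ * H) a = 0 ↔ Matrix.mulVecLin H a = 0 := fun a =>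
    Matrix.conjTranspose_mul_self_mulVec_eq_zero H a
  exact ((injective_iff_map_eq_zero (Matrix.mulVecLin (Hᴴ * H))).trans
    (forall_congr' fun a => by rw [h])).trans (injective_iff_map_eq_zero (Matrix.mulVecLin H)).symm

lemma conjTranspose_mulVec_zfVec {M : ℕ} {ι : Type*} [Fintype ι] [DecidableEq ι]
    {H : Matrix (Fin M) ι ℂ} (hH : IsUnit (Hᴴ * H)) (i : ι) :
    Hᴴ *ᵥ zfVec H i = Pi.single i 1 := by
  rw [zfVec, Matrix.mulVec_mulVec, ← Matrix.mul_assoc,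
    Matrix.mul_nonsing_inv _ ((Matrix.isUnit_iff_isUnit_det _).1 hH), Matrix.one_mulVec]

lemma star_col_dotProduct_zfVec {M : ℕ} {ι : Type*} [Fintype ι] [DecidableEq ι]
    {H : Matrix (Fin M) ι ℂ} (hH : IsUnit (Hᴴ * H)) (i j : ι) :
    star (H.col j) ⬝ᵥ zfVec H i = if j = i then 1 else 0 := by
  have := congrFun (conjTranspose_mulVec_zfVec hH i) j
  rw [Pi.single_apply] at this
  exact this

/-- The squared norm of the zero-forcing direction is the inverse of the squared norm of the
component of the column orthogonal to the other columns. -/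
lemma sqNorm_zfVec_mul {M n : ℕ} {ι : Type*} [Fintype ι] [DecidableEq ι]
    {H : Matrix (Fin M) ι ℂ} (hH : IsUnit (Hᴴ * H)) (i : ι) (B : Matrix (Fin n) (Fin M) ℂ)
    (hB0 : ∀ j ≠ i, B *ᵥ H.col j = 0)
    (hB : ∀ v, (∀ j ≠ i, star (H.col j) ⬝ᵥ v = 0) → Bᴴ *ᵥ (B *ᵥ v) = v) :
    sqNorm (zfVec H i) * sqNorm (B *ᵥ H.col i) = 1 := by
  set v := zfVec H i with hv
  have hperp : Bᴴ *ᵥ (B *ᵥ v) = v := by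
    refine hB v fun j hj => ?_
    rw [hv, star_col_dotProduct_zfVec hH, if_neg hj]
  -- The direction lies in the column span and `B` kills every column but the `i`-th, so only the
  -- coefficient `c i` survives under `B`.
  obtain ⟨c, hc⟩ : ∃ c, v = H *ᵥ c := ⟨(Hᴴ * H)⁻¹ *ᵥ Pi.single i 1, by
    rw [hv, zfVec, Matrix.mulVec_mulVec]⟩
  have hBv : B *ᵥ v = c i • (B *ᵥ H.col i) := by
    have : H *ᵥ c = ∑ j, c j • H.col j := by
      rw [Matrix.mulVec_eq_sum]
      refine Finset.sum_congr rfl fun j _ => ?_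
      rw [op_smul_eq_smul]; rfl
    rw [hc, this, Matrix.mulVec_sum, Finset.sum_eq_single i]
    · rw [Matrix.mulVec_smul]
    · intro j _ hj; rw [Matrix.mulVec_smul, hB0 j hj, smul_zero]
    · simp
  have hadj : ∀ x y : Fin M → ℂ, star x ⬝ᵥ (Bᴴ *ᵥ (B *ᵥ y)) = star (B *ᵥ x) ⬝ᵥ (B *ᵥ y) := by
    intro x y
    rw [Matrix.dotProduct_mulVec, Matrix.star_mulVec]
  -- Pairing `v` with column `i` gives `c i ‖B H_i‖² = 1`; pairing it with itself gives `‖v‖² = |c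
  -- i|² ‖B H_i‖²`. Eliminating `c i` leaves the claim.
  have h1 : c i * sqNorm (B *ᵥ H.col i) = 1 := by
    have h := star_col_dotProduct_zfVec hH i i
    rw [if_pos rfl, ← hv, ← hperp, hadj, hBv, dotProduct_smul, star_dotProduct_self,
      smul_eq_mul] at h
    exact h
  have h2 : sqNorm v = ‖c i‖ ^ 2 * sqNorm (B *ᵥ H.col i) := by
    have h := hadj v v
    rw [hperp, star_dotProduct_self, star_dotProduct_self, hBv, sqNorm_smul] at h
    exact_mod_cast h
  have h3 : ‖c i‖ * sqNorm (B *ᵥ H.col i) = 1 := by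
    have := congrArg norm h1
    rwa [norm_mul, Complex.norm_real, Real.norm_of_nonneg (sqNorm_nonneg _), norm_one] at this
  rw [h2, mul_assoc, sq, mul_mul_mul_comm, h3, one_mul]

/-- Orthonormal coordinates of the orthogonal complement of linearly independent vectors. -/
lemma exists_orthonormal_rows {M m : ℕ} {A : Fin m → Fin M → ℂ} (hA : LinearIndependent ℂ A) :
    ∃ B : Matrix (Fin (M - m)) (Fin M) ℂ, B * Bᴴ = 1 ∧ (∀ j, B *ᵥ A j = 0) ∧
      ∀ v, (∀ j, star (A j) ⬝ᵥ v = 0) → Bᴴ *ᵥ (B *ᵥ v) = v := by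
  let A' : Fin m → EuclideanSpace ℂ (Fin M) := fun j => WithLp.toLp 2 (A j)
  have hA' : LinearIndependent ℂ A' :=
    hA.map' (WithLp.linearEquiv 2 ℂ (Fin M → ℂ)).symm.toLinearMap (LinearEquiv.ker _)
  let W := (Submodule.span ℂ (Set.range A'))ᗮ
  have hfin : Module.finrank ℂ W = M - m := by
    have h := Submodule.finrank_add_finrank_orthogonal (Submodule.span ℂ (Set.range A'))
    rw [finrank_span_eq_card hA', Fintype.card_fin, finrank_euclideanSpace_fin] at h
    have : Module.finrank ℂ W = Module.finrank ℂ (Submodule.span ℂ (Set.range A'))ᗮ := rfl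
    omega
  let b : OrthonormalBasis (Fin (M - m)) ℂ W := (stdOrthonormalBasis ℂ W).reindex (finCongr hfin)
  have hin : ∀ x y : EuclideanSpace ℂ (Fin M), inner ℂ x y = star x.ofLp ⬝ᵥ y.ofLp := by
    intro x y
    rw [EuclideanSpace.inner_eq_star_dotProduct, dotProduct_comm]
  let B : Matrix (Fin (M - m)) (Fin M) ℂ :=
    Matrix.of fun i => star ((b i : EuclideanSpace ℂ (Fin M)).ofLp)
  have hBv : ∀ v i, (B *ᵥ v) i = inner ℂ (b i : EuclideanSpace ℂ (Fin M)) (WithLp.toLp 2 v) := by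
    intro v i; rw [hin]; rfl
  refine ⟨B, ?_, ?_, ?_⟩
  · ext i j
    have h := orthonormal_iff_ite.1 b.orthonormal i j
    rw [Submodule.coe_inner, hin] at h
    rw [Matrix.one_apply, ← h, Matrix.mul_apply]
    simp [B, dotProduct]
  · intro j
    ext i
    rw [hBv]
    exact (Submodule.mem_orthogonal' _ _).1 (b i).2 _ (Submodule.subset_span ⟨j, rfl⟩)
  · intro v hv
    have hvW : (WithLp.toLp 2 v : EuclideanSpace ℂ (Fin M)) ∈ W := by
      rw [Submodule.mem_orthogonal]
      intro u hu
      induction hu using Submodule.span_induction with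
      | mem x h => obtain ⟨j, rfl⟩ := h; rw [hin]; exact hv j
      | zero => simp
      | add x y _ _ hx hy => rw [inner_add_left, hx, hy, add_zero]
      | smul c x _ hx => rw [inner_smul_left, hx, mul_zero]
    -- The rows of `B` are the conjugated basis vectors of the complement, so `Bᴴ (B v)` is the
    -- expansion of `v` in that basis.
    have h := congrArg (fun w : W => (w : EuclideanSpace ℂ (Fin M)).ofLp)
      (b.sum_repr' ⟨WithLp.toLp 2 v, hvW⟩)
    ext m'
    have h' := congrFun h m'
    simp only [Submodule.coe_inner] at h'
    rw [← h']
    have : (Bᴴ *ᵥ (B *ᵥ v)) m' = ∑ i, Bᴴ m' i * (B *ᵥ v) i := rfl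
    simp_rw [this, hBv]
    simp [B, mul_comm]

lemma measurable_mulVec {m n : Type*} [Fintype n] (B : Matrix m n ℂ) :
    Measurable (fun v : n → ℂ => B *ᵥ v) := by
  refine measurable_pi_lambda _ fun i => ?_
  unfold Matrix.mulVec dotProduct
  fun_prop

-- Mean power of the zero-forcing directions of a Gaussian matrix.

lemma measurable_sqNorm {M : ℕ} : Measurable (sqNorm : (Fin M → ℂ) → ℝ) := by
  unfold sqNorm; fun_prop

lemma lintegral_inv_sqNorm_mulVec {M n : ℕ} (hn : 2 ≤ n) {B : Matrix (Fin n) (Fin M) ℂ}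
    (hB : B * Bᴴ = 1) :
    ∫⁻ y, (ENNReal.ofReal (sqNorm (B *ᵥ y)))⁻¹ ∂(stdGaussianVec (Fin M)) =
      ENNReal.ofReal ((n - 1 : ℝ)⁻¹) := by
  rw [← lintegral_inv_sqNorm hn, ← stdGaussianVec_map_mulVec B hB,
    lintegral_map (f := fun z => (ENNReal.ofReal (sqNorm z))⁻¹)
      measurable_sqNorm.ennreal_ofReal.inv (measurable_mulVec B)]

/-- The inverse squared norm is infinite where `B y = 0`, yet has finite mean, so that set is null.
-/
lemma ae_sqNorm_mulVec_pos {M n : ℕ} (hn : 2 ≤ n) {B : Matrix (Fin n) (Fin M) ℂ}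
    (hB : B * Bᴴ = 1) : ∀ᵐ y ∂(stdGaussianVec (Fin M)), 0 < sqNorm (B *ᵥ y) := by
  have hm : Measurable fun y : Fin M → ℂ => (ENNReal.ofReal (sqNorm (B *ᵥ y)))⁻¹ :=
    ((measurable_sqNorm.comp (measurable_mulVec B)).ennreal_ofReal).inv
  filter_upwards [ae_lt_top hm (by rw [lintegral_inv_sqNorm_mulVec hn hB]; simp)] with y hy
  simpa using hy

/-- The kernel of `B` contains the span of `A` but not `y`. -/
lemma linearIndependent_insertNth {M m n : ℕ} {A : Fin m → Fin M → ℂ}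
    (hA : LinearIndependent ℂ A) {B : Matrix (Fin n) (Fin M) ℂ} (hB : ∀ j, B *ᵥ A j = 0)
    {y : Fin M → ℂ} (hy : 0 < sqNorm (B *ᵥ y)) (i : Fin (m + 1)) :
    LinearIndependent ℂ (i.insertNth y A : Fin (m + 1) → Fin M → ℂ) := by
  rw [← linearIndependent_equiv (finSuccEquiv' i).symm, linearIndependent_option]
  refine ⟨?_, ?_⟩
  · convert! hA using 1
    funext j
    rw [Function.comp_apply, Function.comp_apply, finSuccEquiv'_symm_some,
      Fin.insertNth_apply_succAbove]
  · intro hmem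
    have hsub : Submodule.span ℂ (Set.range A) ≤ LinearMap.ker (Matrix.mulVecLin B) := by
      rw [Submodule.span_le]
      rintro _ ⟨j, rfl⟩
      simpa using hB j
    have hr : (i.insertNth y A ∘ (finSuccEquiv' i).symm) ∘ some = A := by
      funext j
      rw [Function.comp_apply, Function.comp_apply, finSuccEquiv'_symm_some,
        Fin.insertNth_apply_succAbove]
    rw [hr, Function.comp_apply, finSuccEquiv'_symm_none, Fin.insertNth_apply_same] at hmem
    have h0 : B *ᵥ y = 0 := by simpa using hsub hmem
    rw [h0] at hy
    simp [sqNorm] at hy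

/-- Isolates column `i`: in the inner integral the other columns are frozen, so the complement of
their span can be treated as deterministic. -/
lemma lintegral_pi_insertNth {E : Type*} [MeasurableSpace E] {μ : Measure E}
    [IsProbabilityMeasure μ] {m : ℕ} (i : Fin (m + 1)) {f : (Fin (m + 1) → E) → ENNReal} (hf : Measurable f) :
    ∫⁻ G, f G ∂(Measure.pi fun _ => μ) =
      ∫⁻ A, ∫⁻ y, f (i.insertNth y A) ∂μ ∂(Measure.pi fun _ : Fin m => μ) := by
  have hp := (measurePreserving_piFinSuccAbove (fun _ : Fin (m + 1) => μ) i).symm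
  rw [← hp.map_eq, lintegral_map hf hp.measurable]
  exact lintegral_prod_symm _ (hf.comp hp.measurable).aemeasurable

lemma ae_pi_of_ae_insertNth {E : Type*} [MeasurableSpace E] {μ : Measure E} [IsProbabilityMeasure μ]
    {m : ℕ} (i : Fin (m + 1)) {p : (Fin (m + 1) → E) → Prop} (hp : MeasurableSet {G | p G})
    (h : ∀ᵐ A ∂(Measure.pi fun _ : Fin m => μ), ∀ᵐ y ∂μ, p (i.insertNth y A)) :
    ∀ᵐ G ∂(Measure.pi fun _ => μ), p G := by
  change (Measure.pi fun _ => μ) {G | p G}ᶜ = 0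
  rw [← lintegral_indicator_one hp.compl,
    lintegral_pi_insertNth i (measurable_one.indicator hp.compl), ← lintegral_zero]
  refine lintegral_congr_ae ?_
  filter_upwards [h] with A hA
  rw [← lintegral_zero]
  refine lintegral_congr_ae ?_
  filter_upwards [hA] with y hy
  exact Set.indicator_of_notMem (Set.notMem_compl_iff.2 hy) _

/-- Fewer than `M` independent standard complex Gaussian vectors of length `M` are almost surely
linearly independent. -/
lemma ae_linearIndependent {M m : ℕ} (hm : m < M) :
    ∀ᵐ G ∂(Measure.pi fun _ : Fin m => stdGaussianVec (Fin M)), LinearIndependent ℂ G := by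
  induction m with
  | zero => exact ae_of_all _ fun G => linearIndependent_empty_type
  | succ m ih =>
    refine ae_pi_of_ae_insertNth 0 isOpen_setOfPred_linearIndependent.measurableSet ?_
    filter_upwards [ih (by omega)] with A hA
    obtain ⟨B, hB1, hB0, -⟩ := exists_orthonormal_rows hA
    -- From `m + 1 < M` the complement of the first `m` vectors has dimension `M - m ≥ 2`, as
    -- positivity requires.
    filter_upwards [ae_sqNorm_mulVec_pos (by omega) hB1] with y hy
    exact linearIndependent_insertNth hA hB0 hy 0

lemma measurable_zfVec {M : ℕ} {ι : Type*} [Fintype ι] [DecidableEq ι] (i : ι) :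
    Measurable fun X : ι → Fin M → ℂ => zfVec (Matrix.of X)ᵀ i := by
  have h1 : Continuous fun X : ι → Fin M → ℂ => ((Matrix.of X)ᵀ : Matrix (Fin M) ι ℂ) := by
    refine continuous_matrix fun m i => ?_
    simp only [Matrix.transpose_apply, Matrix.of_apply]
    fun_prop
  have h2 := h1.matrix_conjTranspose.matrix_mul h1
  have h3 : ∀ a b, Measurable fun X : ι → Fin M → ℂ =>
      (((Matrix.of X)ᵀᴴ * (Matrix.of X)ᵀ : Matrix ι ι ℂ)⁻¹) a b := by
    intro a b
    -- The inverse equals `det⁻¹ • adjugate` everywhere, with `0⁻¹ = 0` at singular matrices, so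
    -- measurability needs no invertibility.
    simp only [Matrix.inv_def, Matrix.smul_apply, Ring.inverse_eq_inv', smul_eq_mul]
    exact (h2.matrix_det.measurable.inv).mul (h2.matrix_adjugate.matrix_elem a b).measurable
  refine measurable_pi_lambda _ fun m => ?_
  have h4 : (fun X : ι → Fin M → ℂ => zfVec (Matrix.of X)ᵀ i m) = fun X =>
      ∑ a, X a m * (((Matrix.of X)ᵀᴴ * (Matrix.of X)ᵀ : Matrix ι ι ℂ)⁻¹) a i := by
    ext X
    simp [zfVec, Matrix.mul_apply]
  rw [h4]
  refine Finset.measurable_sum _ fun a _ => Measurable.mul ?_ (h3 a i)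
  fun_prop

/-- Mean squared norm of the zero-forcing directions of a matrix with independent complex
Gaussian columns. -/
lemma lintegral_sqNorm_zfVec {M K : ℕ} (hK : K < M) (i : Fin K) {s : Fin K → ℝ}
    (hs : ∀ j, 0 < s j) :
    ∫⁻ G, ENNReal.ofReal (sqNorm (zfVec (Matrix.of fun j => (√(s j) : ℂ) • G j)ᵀ i))
      ∂(Measure.pi fun _ : Fin K => stdGaussianVec (Fin M)) =
      ENNReal.ofReal (((M - K : ℝ) * s i)⁻¹) := by
  obtain ⟨m, rfl⟩ : ∃ m, K = m + 1 := ⟨K - 1, by have := i.pos; omega⟩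
  have hmeas : Measurable fun G : Fin (m + 1) → Fin M → ℂ =>
      ENNReal.ofReal (sqNorm (zfVec (Matrix.of fun j => (√(s j) : ℂ) • G j)ᵀ i)) := by
    have e : Measurable fun (G : Fin (m + 1) → Fin M → ℂ) j => (√(s j) : ℂ) • G j :=
      by fun_prop
    exact (measurable_sqNorm.comp ((measurable_zfVec i).comp e)).ennreal_ofReal
  rw [lintegral_pi_insertNth i hmeas]
  -- With the other `m = K - 1` columns fixed, the squared norm is `1 / (s i ‖B y‖²)` and `B y` is
  -- standard Gaussian of dimension `M - m`; its mean inverse squared norm is `1 / (M - m - 1) = 1 /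
  -- (M - K)`.
  have key : ∀ A : Fin m → Fin M → ℂ, LinearIndependent ℂ A →
      ∫⁻ y, ENNReal.ofReal (sqNorm (zfVec (Matrix.of fun j => (√(s j) : ℂ) •
        (i.insertNth y A : Fin (m + 1) → Fin M → ℂ) j)ᵀ i)) ∂(stdGaussianVec (Fin M)) =
      ENNReal.ofReal (((M - (m + 1 : ℕ) : ℝ) * s i)⁻¹) := by
    intro A hA
    obtain ⟨B, hB1, hB0, hBv⟩ := exists_orthonormal_rows hA
    have hn : 2 ≤ M - m := by omega
    calc _ = ∫⁻ y, ENNReal.ofReal (s i)⁻¹ * (ENNReal.ofReal (sqNorm (B *ᵥ y)))⁻¹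
          ∂(stdGaussianVec (Fin M)) := by
          refine lintegral_congr_ae ?_
          filter_upwards [ae_sqNorm_mulVec_pos hn hB1] with y hy
          set G : Fin (m + 1) → Fin M → ℂ := i.insertNth y A with hG
          have hLI := linearIndependent_insertNth hA hB0 hy i
          set H : Matrix (Fin M) (Fin (m + 1)) ℂ := (Matrix.of fun j => (√(s j) : ℂ) • G j)ᵀ with hH
          have hs' : ∀ j, (√(s j) : ℂ) ≠ 0 := fun j => by
            exact_mod_cast (Real.sqrt_pos.2 (hs j)).ne'
          have hcol : ∀ j, H.col j = (√(s j) : ℂ) • G j := fun j => rfl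
          have hunit : IsUnit (Hᴴ * H) := by
            rw [isUnit_gram_iff]
            exact hLI.units_smul (fun j => Units.mk0 _ (hs' j))
          have hsucc : ∀ j ≠ i, ∃ j', j = i.succAbove j' := fun j hj =>
            (Fin.exists_succAbove_eq hj).imp fun _ h => h.symm
          have h := sqNorm_zfVec_mul hunit i B
            (by
              intro j hj
              obtain ⟨j', rfl⟩ := hsucc j hj
              rw [hcol, Matrix.mulVec_smul, hG, Fin.insertNth_apply_succAbove, hB0, smul_zero])
            (by
              intro v hv
              refine hBv v fun j' => ?_
              have := hv _ (Fin.succAbove_ne i j')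
              rw [hcol, hG, Fin.insertNth_apply_succAbove, star_smul, smul_dotProduct,
                smul_eq_zero] at this
              exact this.resolve_left (by simpa using hs' _))
          rw [hcol, hG, Fin.insertNth_apply_same, Matrix.mulVec_smul, sqNorm_smul,
            Complex.norm_real, Real.norm_of_nonneg (Real.sqrt_nonneg _),
            Real.sq_sqrt (hs i).le] at h
          rw [← ENNReal.ofReal_inv_of_pos hy, ← ENNReal.ofReal_mul (inv_nonneg.2 (hs i).le)]
          congr 1
          rw [← mul_inv]
          exact eq_inv_of_mul_eq_one_left h
      _ = _ := by
          rw [lintegral_const_mul' _ _ (by simp), lintegral_inv_sqNorm_mulVec hn hB1,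
            ← ENNReal.ofReal_mul (inv_nonneg.2 (hs i).le), ← mul_inv, mul_comm]
          rw [Nat.cast_sub (by omega)]
          congr 3
          push_cast; ring
  rw [lintegral_congr_ae (g := fun _ => ENNReal.ofReal (((M - (m + 1 : ℕ) : ℝ) * s i)⁻¹))]
  · simp
  · filter_upwards [ae_linearIndependent (M := M) (m := m) (by omega)] with A hA
    exact key A hA


-- White random vectors and their products with independent vectors.

/-- A square integrable centred random vector with covariance matrix `v • 1`. -/
structure IsWhite {M : ℕ} {Ω : Type*} [MeasurableSpace Ω] (P : Measure Ω) (X : Ω → Fin M → ℂ)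
    (v : ℝ) : Prop where
  memLp : ∀ m, MemLp (fun ω => X ω m) 2 P
  mean : ∀ m, ∫ ω, X ω m ∂P = 0
  cov : ∀ m m', ∫ ω, X ω m * conj (X ω m') ∂P = if m = m' then (v : ℂ) else 0

variable {Ω : Type*} [MeasurableSpace Ω] {P : Measure Ω}

lemma memLp_complexGaussian {X : Ω → ℂ} {v : ℝ} (hX : HasLaw X (complexGaussian v) P) :
    MemLp X 2 P := by
  have h := memLp_id_complexGaussian v
  rw [← hX.map_eq, memLp_map_measure_iff (by fun_prop) hX.aemeasurable] at h
  exact h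

lemma integral_complexGaussian {X : Ω → ℂ} {v : ℝ} (hv : 0 ≤ v)
    (hX : HasLaw X (complexGaussian v) P) : ∫ ω, X ω ∂P = 0 := by
  rw [hX.integral_eq, integral_id_complexGaussian hv]

lemma integral_mul_conj_complexGaussian {X : Ω → ℂ} {v : ℝ} (hv : 0 ≤ v)
    (hX : HasLaw X (complexGaussian v) P) : ∫ ω, X ω * conj (X ω) ∂P = v := by
  have h := hX.integral_comp (f := fun z : ℂ => ‖z‖ ^ 2) (by fun_prop)
  rw [integral_norm_sq_complexGaussian hv] at h
  rw [← h, ← integral_complex_ofReal]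
  refine integral_congr_ae (ae_of_all _ fun ω => ?_)
  simp [Complex.mul_conj']

lemma memLp_conj {X : Ω → ℂ} (hX : MemLp X 2 P) : MemLp (fun ω => conj (X ω)) 2 P :=
  hX.star

lemma integrable_mul_conj {X Y : Ω → ℂ} (hX : MemLp X 2 P) (hY : MemLp Y 2 P) :
    Integrable (fun ω => X ω * conj (Y ω)) P :=
  hX.integrable_mul (memLp_conj hY)

lemma isWhite_of_iIndepFun [IsProbabilityMeasure P] {M : ℕ} {X : Ω → Fin M → ℂ} {v : ℝ}
    (hv : 0 ≤ v) (hX : ∀ m, HasLaw (fun ω => X ω m) (complexGaussian v) P)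
    (hind : iIndepFun (fun m ω => X ω m) P) : IsWhite P X v where
  memLp m := memLp_complexGaussian (hX m)
  mean m := integral_complexGaussian hv (hX m)
  cov m m' := by
    split_ifs with h
    · subst h
      exact integral_mul_conj_complexGaussian hv (hX m)
    · have hi : IndepFun (fun ω => X ω m) (fun ω => conj (X ω m')) P :=
        (hind.indepFun h).comp measurable_id (by fun_prop)
      rw [hi.integral_fun_mul_eq_mul_integral (hX m).aemeasurable.aestronglyMeasurable
        (memLp_conj (memLp_complexGaussian (hX m'))).aestronglyMeasurable,
        integral_complexGaussian hv (hX m), zero_mul]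

/-- Without independence the product would only be integrable; here `|X|²` and `|Y|²` are
independent and integrable. -/
lemma memLp_mul_of_indepFun {X Y : Ω → ℂ} (hX : MemLp X 2 P) (hY : MemLp Y 2 P)
    (h : IndepFun X Y P) : MemLp (fun ω => X ω * Y ω) 2 P := by
  have hm : AEStronglyMeasurable (fun ω => X ω * Y ω) P :=
    hX.aestronglyMeasurable.mul hY.aestronglyMeasurable
  rw [memLp_two_iff_integrable_sq_norm hm]
  have hi : IndepFun (fun ω => ‖X ω‖ ^ 2) (fun ω => ‖Y ω‖ ^ 2) P :=
    h.comp (φ := fun z : ℂ => ‖z‖ ^ 2) (ψ := fun z : ℂ => ‖z‖ ^ 2) (by fun_prop) (by fun_prop)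
  refine (hi.integrable_mul ((memLp_two_iff_integrable_sq_norm hX.aestronglyMeasurable).1 hX)
    ((memLp_two_iff_integrable_sq_norm hY.aestronglyMeasurable).1 hY)).congr
    (ae_of_all _ fun ω => ?_)
  simp [mul_pow]

lemma integrable_sqNorm {M : ℕ} {V : Ω → Fin M → ℂ} (hV : ∀ m, MemLp (fun ω => V ω m) 2 P) :
    Integrable (fun ω => sqNorm (V ω)) P := by
  unfold sqNorm
  exact integrable_finsetSum _ fun m _ =>
    (memLp_two_iff_integrable_sq_norm (hV m).aestronglyMeasurable).1 (hV m)

lemma integral_sqNorm_eq {M : ℕ} {V : Ω → Fin M → ℂ} (hV : ∀ m, MemLp (fun ω => V ω m) 2 P) :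
    ((∫ ω, sqNorm (V ω) ∂P : ℝ) : ℂ) = ∑ m, ∫ ω, V ω m * conj (V ω m) ∂P := by
  rw [← integral_finsetSum _ fun m _ => integrable_mul_conj (hV m) (hV m),
    ← integral_complex_ofReal]
  refine integral_congr_ae (ae_of_all _ fun ω => ?_)
  simp [sqNorm, Complex.mul_conj']

namespace IsWhite

variable {M : ℕ} {X V : Ω → Fin M → ℂ} {v : ℝ}

lemma indepFun_entries (h : IndepFun X V P) (m m' : Fin M) :
    IndepFun (fun ω => conj (X ω m)) (fun ω => V ω m') P :=
  h.comp (φ := fun x : Fin M → ℂ => conj (x m)) (ψ := fun x : Fin M → ℂ => x m')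
    (by fun_prop) (by fun_prop)

lemma memLp_dotProduct (hX : IsWhite P X v) (hV : ∀ m, MemLp (fun ω => V ω m) 2 P)
    (h : IndepFun X V P) : MemLp (fun ω => star (X ω) ⬝ᵥ V ω) 2 P :=
  memLp_finsetSum _ fun m _ =>
    memLp_mul_of_indepFun (memLp_conj (hX.memLp m)) (hV m) (indepFun_entries h m m)

lemma integral_dotProduct [IsProbabilityMeasure P] (hX : IsWhite P X v)
    (hV : ∀ m, MemLp (fun ω => V ω m) 2 P) (h : IndepFun X V P) :
    ∫ ω, star (X ω) ⬝ᵥ V ω ∂P = 0 := by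
  have : ∀ m, ∫ ω, conj (X ω m) * V ω m ∂P = 0 := fun m => by
    rw [(indepFun_entries h m m).integral_fun_mul_eq_mul_integral
      (memLp_conj (hX.memLp m)).aestronglyMeasurable (hV m).aestronglyMeasurable, integral_conj, hX.mean]
    simp
  simp only [dotProduct, Pi.star_apply]
  rw [integral_finsetSum]
  · exact Finset.sum_eq_zero fun m _ => this m
  · intro m _
    exact (memLp_conj (hX.memLp m)).integrable_mul (hV m)

/-- After expanding the square, independence splits off the factors `E{X_{m'} conj X_m}`, which
vanish off the diagonal. Only the second moments of `X` matter, not Gaussianity. -/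
lemma integral_norm_sq_dotProduct (hX : IsWhite P X v)
    (hV : ∀ m, MemLp (fun ω => V ω m) 2 P) (h : IndepFun X V P) :
    ∫ ω, ‖star (X ω) ⬝ᵥ V ω‖ ^ 2 ∂P = v * ∫ ω, sqNorm (V ω) ∂P := by
  have hexp : ∀ ω, ((‖star (X ω) ⬝ᵥ V ω‖ ^ 2 : ℝ) : ℂ) =
      ∑ m, ∑ m', (X ω m' * conj (X ω m)) * (V ω m * conj (V ω m')) := by
    intro ω
    have : ((‖star (X ω) ⬝ᵥ V ω‖ ^ 2 : ℝ) : ℂ) =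
        (star (X ω) ⬝ᵥ V ω) * conj (star (X ω) ⬝ᵥ V ω) := by
      rw [Complex.mul_conj']; push_cast; rfl
    rw [this]
    simp only [dotProduct, map_sum, Pi.star_apply, map_mul, Finset.sum_mul_sum, RCLike.star_def,
      Complex.conj_conj]
    refine Finset.sum_congr rfl fun m _ => Finset.sum_congr rfl fun m' _ => by ring
  have hind : ∀ m m', IndepFun (fun ω => X ω m' * conj (X ω m))
      (fun ω => V ω m * conj (V ω m')) P := fun m m' =>
    h.comp (φ := fun x : Fin M → ℂ => x m' * conj (x m))
      (ψ := fun x : Fin M → ℂ => x m * conj (x m')) (by fun_prop) (by fun_prop)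
  have hiX : ∀ m m', Integrable (fun ω => X ω m' * conj (X ω m)) P := fun m m' =>
    integrable_mul_conj (hX.memLp m') (hX.memLp m)
  have hiV : ∀ m m', Integrable (fun ω => V ω m * conj (V ω m')) P := fun m m' =>
    integrable_mul_conj (hV m) (hV m')
  have hint : ∀ m m', Integrable
      (fun ω => (X ω m' * conj (X ω m)) * (V ω m * conj (V ω m'))) P := fun m m' =>
    (hind m m').integrable_mul (hiX m m') (hiV m m')
  have : ((∫ ω, ‖star (X ω) ⬝ᵥ V ω‖ ^ 2 ∂P : ℝ) : ℂ) = ((v * ∫ ω, sqNorm (V ω) ∂P : ℝ) : ℂ) := by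
    rw [← integral_complex_ofReal]
    simp_rw [hexp]
    rw [integral_finsetSum _ fun m _ => integrable_finsetSum _ fun m' _ => hint m m',
      Complex.ofReal_mul, integral_sqNorm_eq hV, Finset.mul_sum]
    refine Finset.sum_congr rfl fun m _ => ?_
    rw [integral_finsetSum _ fun m' _ => hint m m', Finset.sum_eq_single m]
    · rw [(hind m m).integral_fun_mul_eq_mul_integral (hiX m m).aestronglyMeasurable
        (hiV m m).aestronglyMeasurable, hX.cov, if_pos rfl]
    · intro m' _ hm'
      rw [(hind m m').integral_fun_mul_eq_mul_integral (hiX m m').aestronglyMeasurable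
        (hiV m m').aestronglyMeasurable, hX.cov, if_neg hm', zero_mul]
    · simp
  exact_mod_cast this

end IsWhite

lemma hasLaw_curry_stdGaussianVec {ι κ : Type*} [Fintype ι] [Fintype κ] {Z : Ω → ι × κ → ℂ}
    (hZ : HasLaw Z (stdGaussianVec (ι × κ)) P) :
    HasLaw (fun ω i j => Z ω (i, j)) (Measure.pi fun _ : ι => stdGaussianVec κ) P := by
  have h := Measure.infinitePi_map_curry (fun (_ : ι) (_ : κ) => complexGaussian 1)
  simp only [Measure.infinitePi_eq_pi] at h
  have hm : MeasurePreserving (MeasurableEquiv.curry ι κ ℂ) (stdGaussianVec (ι × κ))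
    (Measure.pi fun _ : ι => stdGaussianVec κ) := ⟨MeasurableEquiv.measurable _, h⟩
  exact hm.comp_hasLaw hZ

/-- The same mixing `C` acts at every antenna, that is, `C ⊗ 1` acts on the whole array, and it
inherits orthonormal rows from `C`. -/
lemma hasLaw_mulVec_kronecker {ι κ : Type*} [Fintype ι] [Fintype κ] [DecidableEq κ] {M : ℕ}
    {Z : Ω → ι × Fin M → ℂ} (hZ : HasLaw Z (stdGaussianVec (ι × Fin M)) P) (C : Matrix κ ι ℂ)
    (hC : C * Cᴴ = 1) :
    HasLaw (fun ω (o : κ) (m : Fin M) => ∑ i, C o i * Z ω (i, m))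
      (Measure.pi fun _ : κ => stdGaussianVec (Fin M)) P := by
  open scoped Kronecker in
  have hB : (C ⊗ₖ (1 : Matrix (Fin M) (Fin M) ℂ)) * (C ⊗ₖ (1 : Matrix (Fin M) (Fin M) ℂ))ᴴ = 1 := by
    rw [Matrix.conjTranspose_kronecker, ← Matrix.mul_kronecker_mul, hC]
    simp
  have hm : MeasurePreserving (fun z => (Matrix.kroneckerMap (· * ·) C (1 : Matrix (Fin M) (Fin M) ℂ)) *ᵥ z)
      (stdGaussianVec (ι × Fin M)) (stdGaussianVec (κ × Fin M)) :=
    ⟨measurable_mulVec _, stdGaussianVec_map_mulVec _ hB⟩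
  have h := hasLaw_curry_stdGaussianVec (hm.comp_hasLaw hZ)
  convert! h using 4 with ω o m
  simp [Matrix.mulVec, dotProduct, Fintype.sum_prod_type, Matrix.one_apply]

lemma isWhite_of_hasLaw [IsProbabilityMeasure P] {M : ℕ} {X : Ω → Fin M → ℂ}
    (hX : HasLaw X (stdGaussianVec (Fin M)) P) : IsWhite P X 1 := by
  have h := (iIndepFun_iff_hasLaw_pi_pi (X := fun m ω => X ω m) (μ := fun _ => complexGaussian 1) (P := P)
    (fun m => ((measurePreserving_eval (fun _ : Fin M => complexGaussian 1) m).comp_hasLaw hX))).2 hX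
  exact isWhite_of_iIndepFun zero_le_one (fun m =>
    ((measurePreserving_eval (fun _ : Fin M => complexGaussian 1) m).comp_hasLaw hX)) h


-- Rotation of fading and noise into observations and estimation error.

namespace Params

variable {M N KI KE τI τE : ℕ} (S : Params M N KI KE τI τE)

/-- Variance of the entries of the observation of the channel of information user `k`, when its
pilot is not reused. -/
def obsVar (k : Fin KI) : ℝ := S.pilotEnergy * S.βBI k + S.σ2

lemma pilotEnergy_nonneg : 0 ≤ S.pilotEnergy := mul_nonneg (Nat.cast_nonneg _) S.p_pos.le

lemma pilotEnergy_pos (h : 0 < τI + τE) : 0 < S.pilotEnergy :=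
  mul_pos (Nat.cast_pos.2 h) S.p_pos

lemma obsVar_pos (k : Fin KI) : 0 < S.obsVar k :=
  add_pos_of_nonneg_of_pos (mul_nonneg S.pilotEnergy_nonneg (S.βBI_pos k).le) S.σ2_pos

lemma pilotE_dot_φI (l : Fin KE) (j : Fin τI) : star (S.pilotE l) ⬝ᵥ S.φI j = 0 := by
  have h := congrArg star (S.φI_orth_φE j (S.iE l))
  rw [Matrix.star_dotProduct, star_star, star_zero, dotProduct_comm] at h
  rw [pilotE]
  simpa [dotProduct_comm] using h

lemma pilotI_dot_φI (hpilot : Function.Injective S.iI) (k k' : Fin KI) :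
    star (S.pilotI k') ⬝ᵥ S.φI (S.iI k) = if k' = k then 1 else 0 := by
  rw [pilotI, S.φI_orthonormal]
  simp [hpilot.eq_iff]

lemma cH_eq (hpilot : Function.Injective S.iI) (k : Fin KI) :
    S.cH k = √S.pilotEnergy * S.βBI k / S.obsVar k := by
  unfold cH obsVar
  congr 2
  rw [show S.pilotI k = S.φI (S.iI k) from rfl]
  simp_rw [S.pilotE_dot_φI, S.pilotI_dot_φI hpilot]
  have : ∀ k', ‖(if k' = k then 1 else 0 : ℂ)‖ ^ 2 = if k' = k then (1 : ℝ) else 0 := fun k' => by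
    split_ifs <;> simp
  simp [this]

/-- Fraction of the power of an observation that is due to the channel, as a square root. -/
def cosI (k : Fin KI) : ℝ := √(S.pilotEnergy * S.βBI k / S.obsVar k)

/-- Fraction of the power of an observation that is due to the noise, as a square root. -/
def sinI (k : Fin KI) : ℝ := √(S.σ2 / S.obsVar k)

lemma cosI_sq (k : Fin KI) : S.cosI k ^ 2 = S.pilotEnergy * S.βBI k / S.obsVar k :=
  Real.sq_sqrt (div_nonneg (mul_nonneg S.pilotEnergy_nonneg (S.βBI_pos k).le) (S.obsVar_pos k).le)

lemma sinI_sq (k : Fin KI) : S.sinI k ^ 2 = S.σ2 / S.obsVar k :=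
  Real.sq_sqrt (div_nonneg S.σ2_pos.le (S.obsVar_pos k).le)

lemma cosI_sq_add_sinI_sq (k : Fin KI) : S.cosI k ^ 2 + S.sinI k ^ 2 = 1 := by
  rw [cosI_sq, sinI_sq, ← add_div]
  exact div_self (S.obsVar_pos k).ne'

/-- Links the system constants to the angle of the rotation; consequently `β - γ = β sin²`. -/
lemma γ_eq (hpilot : Function.Injective S.iI) (k : Fin KI) :
    S.γ k = S.βBI k * S.cosI k ^ 2 := by
  have h := Real.mul_self_sqrt S.pilotEnergy_nonneg
  rw [γ, S.cH_eq hpilot, cosI_sq]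
  calc _ = (√S.pilotEnergy * √S.pilotEnergy) * S.βBI k ^ 2 / S.obsVar k := by ring
    _ = _ := by rw [h]; ring

lemma sqrt_obsVar_mul_cosI (k : Fin KI) :
    √(S.obsVar k) * S.cosI k = √S.pilotEnergy * √(S.βBI k) := by
  rw [cosI, ← Real.sqrt_mul (S.obsVar_pos k).le, mul_div_cancel₀ _ (S.obsVar_pos k).ne',
    Real.sqrt_mul S.pilotEnergy_nonneg]

lemma sqrt_obsVar_mul_sinI (k : Fin KI) : √(S.obsVar k) * S.sinI k = √S.σ2 := by
  rw [sinI, ← Real.sqrt_mul (S.obsVar_pos k).le, mul_div_cancel₀ _ (S.obsVar_pos k).ne']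

/-- The rotation that maps the fading of the information users and the noise to the normalized
observations of the channels and the normalized estimation error of the channel of user `k`. -/
def rotation (e : Fin KI ≃ Fin τI) (k : Fin KI) :
    Matrix (Option (Fin τI)) (Fin KI ⊕ Fin (τI + τE)) ℂ :=
  Matrix.of fun o => o.elim
    (Sum.elim (Pi.single k (S.sinI k : ℂ)) (-(S.cosI k : ℂ) • S.φI (e k)))
    (fun j => Sum.elim (Pi.single (e.symm j) (S.cosI (e.symm j) : ℂ))
      ((S.sinI (e.symm j) : ℂ) • S.φI j))

lemma φI_dot_star (i j : Fin τI) : S.φI i ⬝ᵥ star (S.φI j) = if i = j then 1 else 0 := by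
  rw [dotProduct_comm, S.φI_orthonormal]
  simp [eq_comm]

/-- Observation rows of different users have disjoint fading supports and orthogonal pilots. The
error row overlaps only with the observation row of user `k`, and there the products `sin cos` and
`-cos sin` cancel. -/
lemma rotation_mul_conjTranspose (e : Fin KI ≃ Fin τI) (k : Fin KI) :
    S.rotation e k * (S.rotation e k)ᴴ = 1 := by
  have hcs : ∀ t, (S.cosI t : ℂ) * S.cosI t + S.sinI t * S.sinI t = 1 := fun t => by
    have := S.cosI_sq_add_sinI_sq t
    rw [sq, sq] at this
    exact_mod_cast this
  have hmul : ∀ o o', (S.rotation e k * (S.rotation e k)ᴴ) o o' =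
      (fun t => S.rotation e k o (.inl t)) ⬝ᵥ star (fun t => S.rotation e k o' (.inl t)) +
      (fun s => S.rotation e k o (.inr s)) ⬝ᵥ star (fun s => S.rotation e k o' (.inr s)) := by
    intro o o'
    rw [Matrix.mul_apply, Fintype.sum_sum_type]; rfl
  have hstar : ∀ (t : Fin KI) (c : ℝ), star (Pi.single t (c : ℂ) : Fin KI → ℂ) = Pi.single t (c : ℂ) := by
    intro t c
    ext i
    by_cases h : i = t
    · subst h; simp
    · simp [h]
  ext o o'
  rw [hmul]
  rcases o with _ | j <;> rcases o' with _ | j'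
  · change (Pi.single k (S.sinI k : ℂ)) ⬝ᵥ star (Pi.single k (S.sinI k : ℂ) : Fin KI → ℂ) +
      (-(S.cosI k : ℂ) • S.φI (e k)) ⬝ᵥ star (-(S.cosI k : ℂ) • S.φI (e k)) = _
    rw [hstar, star_smul, smul_dotProduct, dotProduct_smul, S.φI_dot_star]
    simp
    linear_combination hcs k
  · change (Pi.single k (S.sinI k : ℂ)) ⬝ᵥ
        star (Pi.single (e.symm j') (S.cosI (e.symm j') : ℂ) : Fin KI → ℂ) +
      (-(S.cosI k : ℂ) • S.φI (e k)) ⬝ᵥ star ((S.sinI (e.symm j') : ℂ) • S.φI j') = _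
    rw [hstar, star_smul, smul_dotProduct, dotProduct_smul, S.φI_dot_star]
    obtain ⟨t, rfl⟩ := e.surjective j'
    by_cases h : k = t
    · subst h; simp; ring
    · simp [h]
  · change (Pi.single (e.symm j) (S.cosI (e.symm j) : ℂ)) ⬝ᵥ
        star (Pi.single k (S.sinI k : ℂ) : Fin KI → ℂ) +
      ((S.sinI (e.symm j) : ℂ) • S.φI j) ⬝ᵥ star (-(S.cosI k : ℂ) • S.φI (e k)) = _
    rw [hstar, star_smul, smul_dotProduct, dotProduct_smul, S.φI_dot_star]
    obtain ⟨t, rfl⟩ := e.surjective j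
    by_cases h : t = k
    · subst h; simp; ring
    · simp [h]
  · change (Pi.single (e.symm j) (S.cosI (e.symm j) : ℂ)) ⬝ᵥ
        star (Pi.single (e.symm j') (S.cosI (e.symm j') : ℂ) : Fin KI → ℂ) +
      ((S.sinI (e.symm j) : ℂ) • S.φI j) ⬝ᵥ star ((S.sinI (e.symm j') : ℂ) • S.φI j') = _
    rw [hstar, star_smul, smul_dotProduct, dotProduct_smul, S.φI_dot_star]
    by_cases h : j = j'
    · subst h; simp [hcs]
    · simp [h]

variable {Ω : Type*} {F : Fading M N KI (τI + τE) Ω}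

lemma Yp_mulVec (φ : Fin (τI + τE) → ℂ) (ω : Ω) :
    S.Yp F ω *ᵥ φ = (√S.pilotEnergy : ℂ) • ∑ l, (star (S.pilotE l) ⬝ᵥ φ) • S.g F l ω +
      (√S.pilotEnergy : ℂ) • ∑ k, (star (S.pilotI k) ⬝ᵥ φ) • S.h F k ω + F.noise ω *ᵥ φ := by
  rw [Yp, Matrix.add_mulVec, Matrix.add_mulVec, Matrix.smul_mulVec, Matrix.smul_mulVec,
    Matrix.sum_mulVec, Matrix.sum_mulVec]
  simp_rw [Matrix.vecMulVec_mulVec]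
  simp

lemma Yp_mulVec_φI (e : Fin KI ≃ Fin τI) (he : ⇑e = S.iI) (j : Fin τI) (ω : Ω) :
    S.Yp F ω *ᵥ S.φI j =
      (√S.pilotEnergy : ℂ) • S.h F (e.symm j) ω + F.noise ω *ᵥ S.φI j := by
  obtain ⟨t, rfl⟩ := e.surjective j
  rw [Yp_mulVec, he]
  simp_rw [S.pilotE_dot_φI, S.pilotI_dot_φI (he ▸ e.injective)]
  rw [← he]
  simp

/-- The fading of the information users and the normalized noise. -/
def baseVec (F : Fading M N KI (τI + τE) Ω) (ω : Ω) : (Fin KI ⊕ Fin (τI + τE)) × Fin M → ℂ :=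
  fun i => i.1.elim (fun k => F.H1t ω i.2 k) (fun s => ((√S.σ2)⁻¹ : ℂ) * F.noise ω i.2 s)

/-- The normalized observations of the channels and the normalized estimation error of the
channel of user `k`. -/
def whitened (F : Fading M N KI (τI + τE) Ω) (e : Fin KI ≃ Fin τI) (k : Fin KI) (ω : Ω)
    (o : Option (Fin τI)) (m : Fin M) : ℂ :=
  ∑ i, S.rotation e k o i * S.baseVec F ω (i, m)

variable {S}

lemma whitened_some (e : Fin KI ≃ Fin τI) (k : Fin KI) (ω : Ω) (j : Fin τI) (m : Fin M) :
    S.whitened F e k ω (some j) m = S.cosI (e.symm j) * F.H1t ω m (e.symm j) +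
      S.sinI (e.symm j) * (((√S.σ2)⁻¹ : ℂ) * (F.noise ω *ᵥ S.φI j) m) := by
  simp [whitened, rotation, baseVec, Matrix.mulVec, dotProduct, Finset.mul_sum, Pi.single_apply]
  refine Finset.sum_congr rfl fun s _ => by ring

lemma whitened_none (e : Fin KI ≃ Fin τI) (k : Fin KI) (ω : Ω) (m : Fin M) :
    S.whitened F e k ω none m = S.sinI k * F.H1t ω m k -
      S.cosI k * (((√S.σ2)⁻¹ : ℂ) * (F.noise ω *ᵥ S.φI (e k)) m) := by
  simp [whitened, rotation, baseVec, Matrix.mulVec, dotProduct, Finset.mul_sum, Pi.single_apply,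
    sub_eq_add_neg]
  refine Finset.sum_congr rfl fun s _ => by ring

/-- Inverts the rotation: `cos (cos t + sin n) + sin (sin t - cos n) = t`. The two summands are the
estimate and the estimation error. -/
lemma h_eq_whitened (e : Fin KI ≃ Fin τI) (k : Fin KI) (ω : Ω) :
    S.h F k ω = ((√(S.βBI k) * S.cosI k : ℝ) : ℂ) • S.whitened F e k ω (some (e k)) +
      ((√(S.βBI k) * S.sinI k : ℝ) : ℂ) • S.whitened F e k ω none := by
  ext m
  have : (S.cosI k : ℂ) ^ 2 + (S.sinI k : ℂ) ^ 2 = 1 := by exact_mod_cast S.cosI_sq_add_sinI_sq k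
  simp only [Pi.add_apply, Pi.smul_apply, whitened_some, whitened_none, h, smul_eq_mul,
    Equiv.symm_apply_apply, Complex.ofReal_mul]
  linear_combination (-(√(S.βBI k) : ℂ) * F.H1t ω m k) * this

lemma Yp_mulVec_φI_eq_whitened (e : Fin KI ≃ Fin τI) (he : ⇑e = S.iI) (k : Fin KI) (j : Fin τI)
    (ω : Ω) :
    S.Yp F ω *ᵥ S.φI j = (√(S.obsVar (e.symm j)) : ℂ) • S.whitened F e k ω (some j) := by
  rw [S.Yp_mulVec_φI e he]
  ext m
  have h1 : (√(S.obsVar (e.symm j)) : ℂ) * S.cosI (e.symm j) = √S.pilotEnergy * √(S.βBI (e.symm j)) := by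
    exact_mod_cast S.sqrt_obsVar_mul_cosI (e.symm j)
  have h2 : (√(S.obsVar (e.symm j)) : ℂ) * S.sinI (e.symm j) = √S.σ2 := by
    exact_mod_cast S.sqrt_obsVar_mul_sinI (e.symm j)
  have h3 : (√S.σ2 : ℂ) * (√S.σ2 : ℂ)⁻¹ = 1 :=
    mul_inv_cancel₀ (by exact_mod_cast (Real.sqrt_pos.2 S.σ2_pos).ne')
  simp only [Pi.add_apply, Pi.smul_apply, whitened_some, h, smul_eq_mul]
  linear_combination (-F.H1t ω m (e.symm j)) * h1 -
    ((√S.σ2 : ℂ)⁻¹ * (F.noise ω *ᵥ S.φI j) m) * h2 - (F.noise ω *ᵥ S.φI j) m * h3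

lemma H1hat_eq (e : Fin KI ≃ Fin τI) (he : ⇑e = S.iI) (k : Fin KI) (ω : Ω) :
    S.H1hat F ω = (Matrix.of fun j =>
      (√(S.obsVar (e.symm j)) : ℂ) • S.whitened F e k ω (some j))ᵀ := by
  ext m j
  rw [Matrix.transpose_apply, Matrix.of_apply, ← Yp_mulVec_φI_eq_whitened e he]
  rfl

/-- The index `k` only selects the error row, so one rotation serves the gain of user `k` with the
precoder of any user `t`. -/
lemma zfDir_eq (e : Fin KI ≃ Fin τI) (he : ⇑e = S.iI) (k t : Fin KI) (ω : Ω) :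
    S.zfDir F t ω = zfVec (Matrix.of fun j =>
      (√(S.obsVar (e.symm j)) : ℂ) • S.whitened F e k ω (some j))ᵀ (e t) := by
  rw [zfDir, H1hat_eq e he k, he, zfVec]

variable [MeasurableSpace Ω] {P : Measure Ω}

lemma IsGaussian.aemeasurable_entry (hF : S.IsGaussian P F) (i) : AEMeasurable (F.entry i) P := by
  rcases i with ⟨m, k⟩ | ⟨m, n⟩ | ⟨m, s⟩
  · exact (hF.law_H1t m k).aemeasurable
  · exact (hF.law_H2t m n).aemeasurable
  · exact (hF.law_noise m s).aemeasurable

lemma IsGaussian.hasLaw_baseVec (hF : S.IsGaussian P F) :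
    HasLaw (S.baseVec F) (stdGaussianVec ((Fin KI ⊕ Fin (τI + τE)) × Fin M)) P := by
  -- Embeds the indices into those of all entries, leaving out the surface fading, which does not
  -- reach the observations of the information users.
  let f : (Fin KI ⊕ Fin (τI + τE)) × Fin M →
      (Fin M × Fin KI) ⊕ (Fin M × Fin N) ⊕ (Fin M × Fin (τI + τE)) :=
    fun i => i.1.elim (fun k => .inl (i.2, k)) (fun s => .inr (.inr (i.2, s)))
  have hf : Function.Injective f := by
    rintro ⟨i | i, m⟩ ⟨i' | i', m'⟩ h <;> simp [f] at h ⊢ <;> simp [h]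
  have hind := (hF.indep.precomp hf).comp
    (fun i z => i.1.elim (fun _ => z) (fun _ => ((√S.σ2)⁻¹ : ℂ) * z)) (by
      rintro ⟨i | i, m⟩
      · exact measurable_id
      · exact measurable_const_mul _)
  have h : iIndepFun (fun i ω => S.baseVec F ω i) P := by
    convert! hind using 1
    ext ⟨i | i, m⟩ ω <;> rfl
  refine h.hasLaw_pi ?_
  rintro ⟨i | i, m⟩
  · exact hF.law_H1t m i
  · have hm : MeasurePreserving (fun z : ℂ => (((√S.σ2)⁻¹ : ℝ) : ℂ) * z) (complexGaussian S.σ2)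
        (complexGaussian 1) := by
      refine ⟨by fun_prop, ?_⟩
      rw [complexGaussian_map_smul S.σ2_pos.le]
      congr 1
      rw [inv_pow, Real.sq_sqrt S.σ2_pos.le, inv_mul_cancel₀ S.σ2_pos.ne']
    have := hm.comp_hasLaw (hF.law_noise m i)
    convert! this using 1
    ext ω
    simp [baseVec]

lemma IsGaussian.hasLaw_whitened (hF : S.IsGaussian P F) (e : Fin KI ≃ Fin τI) (k : Fin KI) :
    HasLaw (S.whitened F e k) (Measure.pi fun _ => stdGaussianVec (Fin M)) P :=
  hasLaw_mulVec_kronecker hF.hasLaw_baseVec _ (S.rotation_mul_conjTranspose e k)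

end Params

-- Normalization, and second moments of affine functions of a centred variable.

section Normalize

variable {Ω : Type*} [MeasurableSpace Ω] {P : Measure Ω} {M : ℕ} {V : Ω → Fin M → ℂ}

lemma memLp_normalize (hV : ∀ m, MemLp (fun ω => V ω m) 2 P) (m : Fin M) :
    MemLp (fun ω => normalize P V ω m) 2 P := by
  simp only [normalize, Pi.smul_apply, smul_eq_mul]
  exact (hV m).const_mul _

lemma integral_sqNorm_normalize (hV : 0 < ∫ ω, sqNorm (V ω) ∂P) :
    ∫ ω, sqNorm (normalize P V ω) ∂P = 1 := by
  simp only [normalize, sqNorm_smul, Complex.norm_real]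
  rw [integral_const_mul, Real.norm_eq_abs, sq_abs, div_pow, Real.sq_sqrt hV.le, one_pow,
    one_div_mul_cancel hV.ne']

lemma indepFun_normalize {X : Ω → Fin M → ℂ} (h : IndepFun X V P) :
    IndepFun X (normalize P V) P :=
  h.comp (ψ := fun v => ((1 / √(∫ ω', sqNorm (V ω') ∂P) : ℝ) : ℂ) • v) measurable_id (by fun_prop)

/-- The cross term is real-linear in `Z`, hence has mean zero. -/
lemma integral_norm_sq_const_add_mul [IsProbabilityMeasure P] {Z : Ω → ℂ} (hZ : MemLp Z 2 P)
    (h0 : ∫ ω, Z ω ∂P = 0) (a b : ℂ) :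
    ∫ ω, ‖a + b * Z ω‖ ^ 2 ∂P = ‖a‖ ^ 2 + ‖b‖ ^ 2 * ∫ ω, ‖Z ω‖ ^ 2 ∂P := by
  have h1 : ∀ ω, ‖a + b * Z ω‖ ^ 2 =
      ‖a‖ ^ 2 + ‖b‖ ^ 2 * ‖Z ω‖ ^ 2 + 2 * (conj a * b * Z ω).re := by
    intro ω
    rw [← Complex.normSq_eq_norm_sq, Complex.normSq_add, Complex.normSq_eq_norm_sq,
      Complex.normSq_eq_norm_sq, norm_mul, mul_pow, ← Complex.conj_re (a * _)]
    simp
    ring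
  have hi : Integrable Z P := hZ.integrable one_le_two
  have hi2 : Integrable (fun ω => ‖Z ω‖ ^ 2) P :=
    (memLp_two_iff_integrable_sq_norm hZ.aestronglyMeasurable).1 hZ
  have h3 : ∫ ω, (conj a * b * Z ω).re ∂P = 0 := by
    have := integral_re (𝕜 := ℂ) (hi.const_mul (conj a * b))
    rw [integral_const_mul, h0, mul_zero] at this
    exact this
  simp_rw [h1]
  have hr : Integrable (fun ω => (conj a * b * Z ω).re) P := (hi.const_mul (conj a * b)).re
  have hs : Integrable (fun ω => ‖a‖ ^ 2 + ‖b‖ ^ 2 * ‖Z ω‖ ^ 2) P :=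
    (integrable_const _).add (hi2.const_mul _)
  rw [integral_add hs (hr.const_mul 2),
    integral_add (integrable_const _) (hi2.const_mul _), integral_const_mul, integral_const_mul, h3]
  simp

end Normalize

-- Zero-forcing precoders: independence, mean power and gains.

namespace Params

variable {M N KI KE τI τE : ℕ} {S : Params M N KI KE τI τE}
variable {Ω : Type*} {F : Fading M N KI (τI + τE) Ω}

/-- The factorization holds at every `ω` and involves only the observation rows, so independence
from the error row passes to the precoder. -/
lemma exists_measurable_zfDir_eq {e : Fin KI ≃ Fin τI} (he : ⇑e = S.iI)
    (k t : Fin KI) :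
    ∃ f : (Fin τI → Fin M → ℂ) → (Fin M → ℂ), Measurable f ∧
      S.zfDir F t = fun ω => f (fun j => S.whitened F e k ω (some j)) := by
  refine ⟨fun G => zfVec (Matrix.of fun j => (√(S.obsVar (e.symm j)) : ℂ) • G j)ᵀ (e t), ?_,
    funext fun ω => zfDir_eq e he k t ω⟩
  have e : Measurable fun (G : Fin τI → Fin M → ℂ) j => (√(S.obsVar (e.symm j)) : ℂ) • G j := by
    fun_prop
  exact (measurable_zfVec _).comp e

variable [MeasurableSpace Ω] {P : Measure Ω}

namespace IsGaussian

lemma hasLaw_whitened_apply (hF : S.IsGaussian P F) (e : Fin KI ≃ Fin τI) (k : Fin KI)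
    (o : Option (Fin τI)) :
    HasLaw (fun ω => S.whitened F e k ω o) (stdGaussianVec (Fin M)) P :=
  (measurePreserving_eval (fun _ : Option (Fin τI) => stdGaussianVec (Fin M)) o).comp_hasLaw
    (hF.hasLaw_whitened e k)

variable [IsProbabilityMeasure P]

lemma iIndepFun_whitened (hF : S.IsGaussian P F) (e : Fin KI ≃ Fin τI) (k : Fin KI) :
    iIndepFun (fun o ω => S.whitened F e k ω o) P :=
  (iIndepFun_iff_hasLaw_pi_pi (hF.hasLaw_whitened_apply e k)).2 (hF.hasLaw_whitened e k)

lemma isWhite_whitened (hF : S.IsGaussian P F) (e : Fin KI ≃ Fin τI) (k : Fin KI)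
    (o : Option (Fin τI)) : IsWhite P (fun ω => S.whitened F e k ω o) 1 :=
  isWhite_of_hasLaw (hF.hasLaw_whitened_apply e k o)

lemma hasLaw_whitened_some (hF : S.IsGaussian P F) (e : Fin KI ≃ Fin τI) (k : Fin KI) :
    HasLaw (fun ω j => S.whitened F e k ω (some j))
      (Measure.pi fun _ : Fin τI => stdGaussianVec (Fin M)) P :=
  ((hF.iIndepFun_whitened e k).precomp (Option.some_injective _)).hasLaw_pi
    fun j => hF.hasLaw_whitened_apply e k (some j)

lemma indepFun_whitened (hF : S.IsGaussian P F) (e : Fin KI ≃ Fin τI) (k : Fin KI) :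
    IndepFun (fun ω => S.whitened F e k ω none) (fun ω j => S.whitened F e k ω (some j)) P := by
  have h := (hF.iIndepFun_whitened e k).indepFun_finset₀ {none} (Finset.univ.map .some) (by simp)
    (fun o => (hF.hasLaw_whitened_apply e k o).aemeasurable)
  exact h.comp (φ := fun x : (({none} : Finset (Option (Fin τI))) → Fin M → ℂ) =>
      x ⟨none, by simp⟩)
    (ψ := fun (x : ((Finset.univ.map .some : Finset (Option (Fin τI))) → Fin M → ℂ)) j =>
      x ⟨some j, by simp⟩) (by fun_prop) (by fun_prop)

variable {e : Fin KI ≃ Fin τI}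

lemma ae_isUnit_gram (hF : S.IsGaussian P F) (he : ⇑e = S.iI) (hM : τI < M) (k : Fin KI) :
    ∀ᵐ ω ∂P, IsUnit ((S.H1hat F ω)ᴴ * S.H1hat F ω) := by
  have hL := hF.hasLaw_whitened_some e k
  have h := ae_linearIndependent hM
  rw [← hL.map_eq] at h
  filter_upwards [ae_of_ae_map hL.aemeasurable h] with ω hω
  rw [H1hat_eq e he k, isUnit_gram_iff]
  have hs : ∀ j, (√(S.obsVar (e.symm j)) : ℂ) ≠ 0 := fun j => by
    exact_mod_cast (Real.sqrt_pos.2 (S.obsVar_pos _)).ne'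
  exact hω.units_smul (fun j => Units.mk0 _ (hs j))

lemma aemeasurable_zfDir (hF : S.IsGaussian P F) (he : ⇑e = S.iI) (t : Fin KI) :
    AEMeasurable (S.zfDir F t) P := by
  obtain ⟨f, hf, h⟩ := exists_measurable_zfDir_eq he t t
  rw [h]
  exact hf.comp_aemeasurable (hF.hasLaw_whitened_some e t).aemeasurable

lemma indepFun_zfDir (hF : S.IsGaussian P F) (he : ⇑e = S.iI) (k t : Fin KI) :
    IndepFun (fun ω => S.whitened F e k ω none) (S.zfDir F t) P := by
  obtain ⟨f, hf, h⟩ := exists_measurable_zfDir_eq he k t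
  rw [h]
  exact (hF.indepFun_whitened e k).comp measurable_id hf

/-- Stated in extended reals so that its finite value also yields square integrability, in
`memLp_zfDir`. -/
lemma lintegral_sqNorm_zfDir (hF : S.IsGaussian P F) (he : ⇑e = S.iI) (hM : τI < M) (t : Fin KI) :
    ∫⁻ ω, ENNReal.ofReal (sqNorm (S.zfDir F t ω)) ∂P =
      ENNReal.ofReal (((M - τI : ℝ) * S.obsVar t)⁻¹) := by
  have h := lintegral_sqNorm_zfVec hM (e t) (s := fun j => S.obsVar (e.symm j))
    (fun j => S.obsVar_pos _)
  have e1 : Measurable fun (G : Fin τI → Fin M → ℂ) j => (√(S.obsVar (e.symm j)) : ℂ) • G j := by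
    fun_prop
  have hm := (measurable_sqNorm.comp ((measurable_zfVec (M := M) (e t)).comp e1)).ennreal_ofReal
  simp_rw [zfDir_eq e he t t]
  rw [Equiv.symm_apply_apply] at h
  rw [← h]
  exact (hF.hasLaw_whitened_some e t).lintegral_comp hm.aemeasurable

lemma memLp_zfDir (hF : S.IsGaussian P F) (he : ⇑e = S.iI) (hM : τI < M) (t : Fin KI)
    (m : Fin M) : MemLp (fun ω => S.zfDir F t ω m) 2 P := by
  have hmeas : AEMeasurable (fun ω => S.zfDir F t ω m) P :=
    (measurable_pi_apply m).comp_aemeasurable (hF.aemeasurable_zfDir he t)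
  rw [memLp_two_iff_integrable_sq_norm hmeas.aestronglyMeasurable]
  have hi : Integrable (fun ω => sqNorm (S.zfDir F t ω)) P := by
    refine ⟨(measurable_sqNorm.comp_aemeasurable
      (hF.aemeasurable_zfDir he t)).aestronglyMeasurable, ?_⟩
    rw [hasFiniteIntegral_iff_ofReal (ae_of_all _ fun ω => sqNorm_nonneg _),
      hF.lintegral_sqNorm_zfDir he hM]
    exact ENNReal.ofReal_lt_top
  refine hi.mono' (hmeas.norm.pow_const 2).aestronglyMeasurable (ae_of_all _ fun ω => ?_)
  rw [Real.norm_of_nonneg (by positivity)]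
  exact Finset.single_le_sum (f := fun m => ‖S.zfDir F t ω m‖ ^ 2) (fun _ _ => by positivity)
    (Finset.mem_univ m)

lemma integral_sqNorm_zfDir (hF : S.IsGaussian P F) (he : ⇑e = S.iI) (hM : τI < M) (t : Fin KI) :
    ∫ ω, sqNorm (S.zfDir F t ω) ∂P = ((M - τI : ℝ) * S.obsVar t)⁻¹ := by
  have hM' : (0 : ℝ) < M - τI := sub_pos.2 (Nat.cast_lt.2 hM)
  have := S.obsVar_pos t
  rw [integral_eq_lintegral_of_nonneg_ae (ae_of_all _ fun ω => sqNorm_nonneg _)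
    (measurable_sqNorm.comp_aemeasurable (hF.aemeasurable_zfDir he t)).aestronglyMeasurable,
    hF.lintegral_sqNorm_zfDir he hM, ENNReal.toReal_ofReal (by positivity)]

lemma integral_sqNorm_zfDir_pos (hF : S.IsGaussian P F) (he : ⇑e = S.iI) (hM : τI < M)
    (t : Fin KI) : 0 < ∫ ω, sqNorm (S.zfDir F t ω) ∂P := by
  have hM' : (0 : ℝ) < M - τI := sub_pos.2 (Nat.cast_lt.2 hM)
  have := S.obsVar_pos t
  rw [hF.integral_sqNorm_zfDir he hM]
  positivity

/-- Where the Gram matrix is invertible, the response of the zero-forcing direction to the observed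
part of `h_k` is deterministic; all randomness of the gain sits in the error term. -/
lemma ae_gain_wPZF (hF : S.IsGaussian P F) (he : ⇑e = S.iI) (hM : τI < M) (k t : Fin KI) :
    S.gain F k (S.wPZF P F t) =ᵐ[P] fun ω =>
      (if t = k then ((√(S.βBI k) * S.cosI k * √(M - τI : ℝ) : ℝ) : ℂ) else 0) +
        ((√(S.βBI k) * S.sinI k : ℝ) : ℂ) *
          (star (S.whitened F e k ω none) ⬝ᵥ S.wPZF P F t ω) := by
  filter_upwards [hF.ae_isUnit_gram he hM k] with ω hω
  have hs : (√(S.obsVar k) : ℂ) ≠ 0 := by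
    exact_mod_cast (Real.sqrt_pos.2 (S.obsVar_pos _)).ne'
  rw [H1hat_eq e he k] at hω
  have h := star_col_dotProduct_zfVec hω (e t) (e k)
  rw [← zfDir_eq e he k t] at h
  have h1 : (√(S.obsVar k) : ℂ) * (star (S.whitened F e k ω (some (e k))) ⬝ᵥ S.zfDir F t ω) =
      if t = k then 1 else 0 := by
    rw [← smul_eq_mul, ← smul_dotProduct]
    have hc : (√(S.obsVar k) : ℂ) • star (S.whitened F e k ω (some (e k))) =
        star ((√(S.obsVar (e.symm (e k))) : ℂ) • S.whitened F e k ω (some (e k))) := by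
      rw [Equiv.symm_apply_apply, star_smul]
      simp
    rw [hc]
    refine h.trans ?_
    simp [eq_comm]
  have hst : ∀ (a : ℝ) (v : Fin M → ℂ), star ((a : ℂ) • v) = (a : ℂ) • star v := by
    intro a v; rw [star_smul]; simp
  rw [gain, h_eq_whitened e k, star_add, hst, hst, add_dotProduct, smul_dotProduct,
    smul_dotProduct, smul_eq_mul, smul_eq_mul]
  congr 1
  rw [wPZF, normalize, dotProduct_smul, smul_eq_mul, hF.integral_sqNorm_zfDir he hM]
  have h2 : star (S.whitened F e k ω (some (e k))) ⬝ᵥ S.zfDir F t ω =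
      (√(S.obsVar k) : ℂ)⁻¹ * if t = k then 1 else 0 := by
    rw [← h1, inv_mul_cancel_left₀ hs]
  rw [h2]
  split_ifs with htk
  · subst htk
    have hM' : (0 : ℝ) < M - τI := sub_pos.2 (Nat.cast_lt.2 hM)
    -- The factor `√(M - τI)` is the response `1 / √obsVar` divided by the root mean power `1 / √((M
    -- - τI) obsVar)`.
    rw [Real.sqrt_inv, one_div, inv_inv, Real.sqrt_mul hM'.le]
    push_cast
    field_simp
  · simp

end IsGaussian

end Params

section MemLp

variable {Ω : Type*} [MeasurableSpace Ω] {P : Measure Ω} {X Y : Ω → ℂ}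

lemma memLp_fun_add (hX : MemLp X 2 P) (hY : MemLp Y 2 P) : MemLp (fun ω => X ω + Y ω) 2 P :=
  hX.add hY

lemma memLp_const_mul (hX : MemLp X 2 P) (c : ℂ) : MemLp (fun ω => c * X ω) 2 P :=
  hX.const_mul c

lemma memLp_const_add [IsFiniteMeasure P] (hX : MemLp X 2 P) (c : ℂ) :
    MemLp (fun ω => c + X ω) 2 P :=
  (memLp_const c).add hX

lemma memLp_add_const [IsFiniteMeasure P] (hX : MemLp X 2 P) (c : ℂ) :
    MemLp (fun ω => X ω + c) 2 P :=
  hX.add (memLp_const c)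

/-- A vector of zero mean power vanishes almost surely, so one nonzero correlation with any `Y`
certifies positive power. -/
lemma integral_sqNorm_pos {M : ℕ} {V : Ω → Fin M → ℂ} (hV : ∀ m, MemLp (fun ω => V ω m) 2 P)
    {m : Fin M} (h : ∫ ω, V ω m * Y ω ∂P ≠ 0) : 0 < ∫ ω, sqNorm (V ω) ∂P := by
  refine lt_of_le_of_ne (integral_nonneg fun ω => sqNorm_nonneg _) fun h0 => h ?_
  rw [eq_comm, integral_eq_zero_iff_of_nonneg (fun ω => sqNorm_nonneg _)
    (integrable_sqNorm hV)] at h0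
  rw [← integral_zero Ω ℂ]
  refine integral_congr_ae ?_
  filter_upwards [h0] with ω hω
  have : ‖V ω m‖ ^ 2 = 0 :=
    (Finset.sum_eq_zero_iff_of_nonneg fun _ _ => by positivity).1 hω m (Finset.mem_univ _)
  rw [norm_eq_zero.1 (pow_eq_zero_iff two_ne_zero |>.1 this), zero_mul]

end MemLp

-- Estimates of the channels of the energy users.

namespace Params

variable {M N KI KE τI τE : ℕ} {S : Params M N KI KE τI τE}

section Pointwise

variable {Ω : Type*} {F : Fading M N KI (τI + τE) Ω}

variable (S) in
lemma pilotI_dot_φE (k : Fin KI) (j : Fin τE) : star (S.pilotI k) ⬝ᵥ S.φE j = 0 :=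
  S.φI_orth_φE _ _

lemma yE_eq (l : Fin KE) (ω : Ω) :
    S.yE F l ω = (√S.pilotEnergy : ℂ) • ∑ l', (star (S.pilotE l') ⬝ᵥ S.pilotE l) • S.g F l' ω +
      F.noise ω *ᵥ S.pilotE l := by
  rw [yE, Yp_mulVec]
  have : ∀ k, star (S.pilotI k) ⬝ᵥ S.pilotE l = 0 := fun k => S.pilotI_dot_φE k _
  simp [this]

lemma g_apply (l : Fin KE) (ω : Ω) (m : Fin M) :
    S.g F l ω m = ∑ n, ((√(S.β / (S.δ + 1)) : ℂ) * ((√S.δ : ℂ) * S.H2bar m n + F.H2t ω m n)) *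
      (S.Θ *ᵥ ((√(S.βRE l) : ℂ) • S.fbar l)) n := rfl

lemma cG_pos (hτ : 0 < τI + τE) (l : Fin KE) : 0 < S.cG l := by
  have hl : ∀ l, 0 < (N : ℝ) * S.lam l := fun l => by
    have h1 := S.βRE_pos l
    have h2 := S.β_pos
    have h3 := S.δ_nonneg
    have h4 : (0 : ℝ) < N := Nat.cast_pos.2 S.N_pos
    unfold lam
    positivity
  refine div_pos (mul_pos (Real.sqrt_pos.2 (S.pilotEnergy_pos hτ)) (hl l))
    (add_pos_of_nonneg_of_pos (mul_nonneg S.pilotEnergy_nonneg (add_nonneg ?_ ?_)) S.σ2_pos)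
  · exact Finset.sum_nonneg fun l' _ => mul_nonneg (hl l').le (sq_nonneg _)
  · exact Finset.sum_nonneg fun k _ => mul_nonneg (S.βBI_pos k).le (sq_nonneg _)

/-- Both estimates of the channel of an energy user are affine in the observation. -/
lemma exists_affine_estimate [MeasurableSpace Ω] {P : Measure Ω} {gEst : Fin KE → Ω → Fin M → ℂ}
    (h : gEst = S.gHat F ∨ gEst = S.gHatMMSE P F) (l : Fin KE) :
    ∃ (A : Matrix (Fin M) (Fin M) ℂ) (b : Fin M → ℂ), gEst l = fun ω => A *ᵥ S.yE F l ω + b := by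
  rcases h with rfl | rfl
  · refine ⟨(S.cG l : ℂ) • 1, S.gMean l - (S.cG l : ℂ) • ((√S.pilotEnergy : ℂ) •
      ∑ l', (star (S.pilotE l') ⬝ᵥ S.pilotE l) • S.gMean l'), funext fun ω => ?_⟩
    rw [gHat, Matrix.smul_mulVec, Matrix.one_mulVec, smul_sub]
    abel
  · refine ⟨crossCov P (S.g F l) (S.yE F l) * (crossCov P (S.yE F l) (S.yE F l))⁻¹,
      mean P (S.g F l) - (crossCov P (S.g F l) (S.yE F l) *
        (crossCov P (S.yE F l) (S.yE F l))⁻¹) *ᵥ mean P (S.yE F l), funext fun ω => ?_⟩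
    rw [gHatMMSE, mmse, Matrix.mulVec_sub]
    abel

variable (S) in
/-- The part of the explicit estimate of the channel of energy user `l` that does not depend on
the noise. -/
def gHatResidual (l : Fin KE) (m : Fin M) (x : Fin KE → Fin M → ℂ) : ℂ :=
  (S.cG l : ℂ) * ((√S.pilotEnergy : ℂ) * ∑ l', (star (S.pilotE l') ⬝ᵥ S.pilotE l) * x l' m -
    (√S.pilotEnergy : ℂ) * ∑ l', (star (S.pilotE l') ⬝ᵥ S.pilotE l) * S.gMean l' m) + S.gMean l m

lemma gHat_apply (l : Fin KE) (ω : Ω) (m : Fin M) :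
    S.gHat F l ω m = (S.cG l : ℂ) * (F.noise ω *ᵥ S.pilotE l) m +
      S.gHatResidual l m (fun l' => S.g F l' ω) := by
  rw [gHat, Pi.add_apply, Pi.smul_apply, Pi.sub_apply, yE_eq, Pi.add_apply]
  simp only [gHatResidual, Pi.smul_apply, Finset.sum_apply, smul_eq_mul]
  ring

/-- Puts a projected noise entry in the form `Xᴴ V` with `X` a noise row and `V` constant, so that
the moment lemmas for white vectors apply. -/
lemma conj_noise_mulVec (φ : Fin (τI + τE) → ℂ) (m : Fin M) (ω : Ω) :
    conj ((F.noise ω *ᵥ φ) m) = star (fun s => F.noise ω m s) ⬝ᵥ star φ := by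
  simp [Matrix.mulVec, dotProduct]

end Pointwise

variable {Ω : Type*} [MeasurableSpace Ω] {P : Measure Ω}
  {F : Fading M N KI (τI + τE) Ω}

lemma measurable_g {F : Fading M N KI (τI + τE) Ω}
    (hF : ∀ m n, Measurable fun ω => F.H2t ω m n) (l : Fin KE) : Measurable (S.g F l) := by
  refine measurable_pi_lambda _ fun m => ?_
  simp_rw [g_apply]
  fun_prop

lemma measurable_noise_mulVec {F : Fading M N KI (τI + τE) Ω}
    (hF : ∀ m s, Measurable fun ω => F.noise ω m s) (φ : Fin (τI + τE) → ℂ) :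
    Measurable fun ω => F.noise ω *ᵥ φ := by
  refine measurable_pi_lambda _ fun m => ?_
  unfold Matrix.mulVec dotProduct
  fun_prop

namespace IsGaussian

lemma memLp_noise_mulVec (hF : S.IsGaussian P F) (φ : Fin (τI + τE) → ℂ) (m : Fin M) :
    MemLp (fun ω => (F.noise ω *ᵥ φ) m) 2 P := by
  simp only [Matrix.mulVec, dotProduct, mul_comm _ (φ _)]
  exact memLp_finsetSum _ fun s _ => memLp_const_mul (memLp_complexGaussian (hF.law_noise m s)) _

lemma memLp_conj_noise_mulVec (hF : S.IsGaussian P F) (φ : Fin (τI + τE) → ℂ) (m : Fin M) :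
    MemLp (fun ω => conj ((F.noise ω *ᵥ φ) m)) 2 P :=
  memLp_conj (hF.memLp_noise_mulVec φ m)

lemma indepFun_h_yE (hF : S.IsGaussian P F) (k : Fin KI) (l : Fin KE) :
    IndepFun (S.h F k) (S.yE F l) P := by
  classical
  let T₁ : Finset ((Fin M × Fin KI) ⊕ (Fin M × Fin N) ⊕ (Fin M × Fin (τI + τE))) :=
    Finset.univ.map .inl
  let T₂ : Finset ((Fin M × Fin KI) ⊕ (Fin M × Fin N) ⊕ (Fin M × Fin (τI + τE))) :=
    Finset.univ.map .inr
  have hd : Disjoint T₁ T₂ := by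
    rw [Finset.disjoint_left]
    rintro _ h1 h2
    obtain ⟨x, -, rfl⟩ := Finset.mem_map.1 h1
    simp [T₂] at h2
  have h1 : ∀ m, .inl (m, k) ∈ T₁ := fun m => by simp [T₁]
  have h2 : ∀ i, .inr i ∈ T₂ := fun i => by simp [T₂]
  -- A copy of the system whose sample space is the block `T₂` of surface fading and noise values.
  -- The fading of the information users may be set to zero since pilot orthogonality removes it
  -- from `yE`; thus `yE` factors through `T₂`.
  let F' : Fading M N KI (τI + τE) (T₂ → ℂ) :=
    { H1t := 0
      H2t := fun x m n => x ⟨.inr (.inl (m, n)), h2 _⟩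
      noise := fun x m s => x ⟨.inr (.inr (m, s)), h2 _⟩ }
  have h := hF.indep.indepFun_finset₀ T₁ T₂ hd hF.aemeasurable_entry
  have hy : S.yE F l = (fun x => (√S.pilotEnergy : ℂ) •
      ∑ l', (star (S.pilotE l') ⬝ᵥ S.pilotE l) • S.g F' l' x + F'.noise x *ᵥ S.pilotE l) ∘
        fun ω (i : T₂) => F.entry i ω := by
    funext ω
    rw [yE_eq]
    rfl
  have hψ : Measurable fun x => (√S.pilotEnergy : ℂ) •
      ∑ l', (star (S.pilotE l') ⬝ᵥ S.pilotE l) • S.g F' l' x + F'.noise x *ᵥ S.pilotE l := by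
    have hg : ∀ l', Measurable (S.g F' l') := fun l' =>
      measurable_g (fun m n => measurable_pi_apply _) l'
    have hn : Measurable fun x => F'.noise x *ᵥ S.pilotE l :=
      measurable_noise_mulVec (fun m n => measurable_pi_apply _) _
    fun_prop
  rw [hy]
  exact h.comp (φ := fun x m => (√(S.βBI k) : ℂ) * x ⟨.inl (m, k), h1 m⟩) (by fun_prop) hψ

lemma indepFun_g_noise (hF : S.IsGaussian P F) :
    IndepFun (fun ω l => S.g F l ω) (fun ω m s => F.noise ω m s) P := by
  classical
  let T₁ : Finset ((Fin M × Fin KI) ⊕ (Fin M × Fin N) ⊕ (Fin M × Fin (τI + τE))) :=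
    Finset.univ.map (Function.Embedding.inl.trans .inr)
  let T₂ : Finset ((Fin M × Fin KI) ⊕ (Fin M × Fin N) ⊕ (Fin M × Fin (τI + τE))) :=
    Finset.univ.map (Function.Embedding.inr.trans .inr)
  have hd : Disjoint T₁ T₂ := by
    rw [Finset.disjoint_left]
    rintro _ h1 h2
    obtain ⟨x, -, rfl⟩ := Finset.mem_map.1 h1
    simp [T₂] at h2
  have h1 : ∀ i, .inr (.inl i) ∈ T₁ := fun m => by simp [T₁]
  have h2 : ∀ i, .inr (.inr i) ∈ T₂ := fun i => by simp [T₂]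
  let F' : Fading M N KI (τI + τE) (T₁ → ℂ) :=
    { H1t := 0
      H2t := fun x m n => x ⟨.inr (.inl (m, n)), h1 _⟩
      noise := 0 }
  have h := hF.indep.indepFun_finset₀ T₁ T₂ hd hF.aemeasurable_entry
  have hg : ∀ l', Measurable (S.g F' l') := fun l' =>
      measurable_g (fun m n => measurable_pi_apply _) l'
  exact h.comp (φ := fun x l => S.g F' l x) (ψ := fun x m s => x ⟨.inr (.inr (m, s)), h2 _⟩)
    (by fun_prop) (by fun_prop)

lemma indepFun_gHatResidual_noise (hF : S.IsGaussian P F) (l : Fin KE) (m : Fin M) :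
    IndepFun (fun ω => S.gHatResidual l m (fun l' => S.g F l' ω))
      (fun ω => conj ((F.noise ω *ᵥ S.pilotE l) m)) P := by
  have h1 : Measurable (S.gHatResidual l m) := by
    unfold gHatResidual
    fun_prop
  have h2 : Measurable fun x : Fin M → Fin (τI + τE) → ℂ => conj (∑ s, x m s * S.pilotE l s) := by
    fun_prop
  exact hF.indepFun_g_noise.comp h1 h2

-- Moments of the zero-forcing gains and of the channel estimates.

variable {e : Fin KI ≃ Fin τI} [IsProbabilityMeasure P]

lemma memLp_wPZF (hF : S.IsGaussian P F) (he : ⇑e = S.iI) (hM : τI < M) (t : Fin KI) (m : Fin M) :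
    MemLp (fun ω => S.wPZF P F t ω m) 2 P :=
  memLp_normalize (hF.memLp_zfDir he hM t) m

lemma indepFun_wPZF (hF : S.IsGaussian P F) (he : ⇑e = S.iI) (k t : Fin KI) :
    IndepFun (fun ω => S.whitened F e k ω none) (S.wPZF P F t) P :=
  indepFun_normalize (hF.indepFun_zfDir he k t)

lemma integral_sqNorm_wPZF (hF : S.IsGaussian P F) (he : ⇑e = S.iI) (hM : τI < M) (t : Fin KI) :
    ∫ ω, sqNorm (S.wPZF P F t ω) ∂P = 1 :=
  integral_sqNorm_normalize (hF.integral_sqNorm_zfDir_pos he hM t)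

lemma memLp_gain_wPZF (hF : S.IsGaussian P F) (he : ⇑e = S.iI) (hM : τI < M) (k t : Fin KI) :
    MemLp (S.gain F k (S.wPZF P F t)) 2 P := by
  refine MemLp.ae_eq (hF.ae_gain_wPZF he hM k t).symm (memLp_const_add (memLp_const_mul ?_ _) _)
  exact (hF.isWhite_whitened e k none).memLp_dotProduct
    (hF.memLp_wPZF he hM t) (hF.indepFun_wPZF he k t)

lemma norm_sq_integral_gain_wPZF (hF : S.IsGaussian P F) (he : ⇑e = S.iI) (hM : τI < M)
    (k : Fin KI) :
    ‖∫ ω, S.gain F k (S.wPZF P F k) ω ∂P‖ ^ 2 = (M - τI : ℝ) * S.γ k := by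
  have hM' : (0 : ℝ) < M - τI := sub_pos.2 (Nat.cast_lt.2 hM)
  have hZ := (hF.isWhite_whitened e k none).memLp_dotProduct
    (hF.memLp_wPZF he hM k) (hF.indepFun_wPZF he k k)
  rw [integral_congr_ae (hF.ae_gain_wPZF he hM k k), integral_add (integrable_const _)
    ((hZ.integrable one_le_two).const_mul _), integral_const_mul,
    (hF.isWhite_whitened e k none).integral_dotProduct (hF.memLp_wPZF he hM k)
      (hF.indepFun_wPZF he k k), mul_zero, add_zero, if_pos rfl, integral_const,
    probReal_univ, one_smul, Complex.norm_real, Real.norm_eq_abs, sq_abs, mul_pow, mul_pow,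
    Real.sq_sqrt (S.βBI_pos k).le, Real.sq_sqrt hM'.le, S.γ_eq (he ▸ e.injective), mul_comm]

/-- Each information stream, the own one included, leaks `β sin² = β - γ` through the estimation
error, because its unit-power precoder is independent of that error. -/
lemma integral_norm_sq_gain_wPZF (hF : S.IsGaussian P F) (he : ⇑e = S.iI) (hM : τI < M)
    (k t : Fin KI) :
    ∫ ω, ‖S.gain F k (S.wPZF P F t) ω‖ ^ 2 ∂P =
      (if t = k then (M - τI : ℝ) * S.γ k else 0) + (S.βBI k - S.γ k) := by
  have hM' : (0 : ℝ) < M - τI := sub_pos.2 (Nat.cast_lt.2 hM)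
  have hw := hF.isWhite_whitened e k none
  have hL := hF.memLp_wPZF he hM t
  have hi := hF.indepFun_wPZF he k t
  have h1 : S.γ k = S.βBI k * S.cosI k ^ 2 := S.γ_eq (he ▸ e.injective) k
  have h2 := S.cosI_sq_add_sinI_sq k
  have hae : (fun ω => ‖S.gain F k (S.wPZF P F t) ω‖ ^ 2) =ᵐ[P] fun ω => ‖(if t = k then
      ((√(S.βBI k) * S.cosI k * √(M - τI : ℝ) : ℝ) : ℂ) else 0) +
        ((√(S.βBI k) * S.sinI k : ℝ) : ℂ) *
          (star (S.whitened F e k ω none) ⬝ᵥ S.wPZF P F t ω)‖ ^ 2 :=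
    (hF.ae_gain_wPZF he hM k t).fun_comp fun z => ‖z‖ ^ 2
  rw [integral_congr_ae hae,
    integral_norm_sq_const_add_mul (hw.memLp_dotProduct hL hi) (hw.integral_dotProduct hL hi),
    hw.integral_norm_sq_dotProduct hL hi, hF.integral_sqNorm_wPZF he hM, Complex.norm_real,
    Real.norm_eq_abs, sq_abs, mul_pow, Real.sq_sqrt (S.βBI_pos k).le]
  congr 1
  · split_ifs
    · rw [Complex.norm_real, Real.norm_eq_abs, sq_abs, mul_pow, mul_pow,
        Real.sq_sqrt (S.βBI_pos k).le, Real.sq_sqrt hM'.le, h1, mul_comm]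
    · simp
  · rw [h1]
    linear_combination S.βBI k * h2

/-- The entries of the MMSE estimate of the channel of an information user have mean square
`γ`. -/
lemma integral_norm_sq_hHat (hF : S.IsGaussian P F) (he : ⇑e = S.iI) (k : Fin KI) (m : Fin M) :
    ∫ ω, ‖S.hHat P F k ω m‖ ^ 2 ∂P = S.γ k := by
  set U := fun ω => S.whitened F e k ω (some (e k)) with hU
  set U₀ := fun ω => S.whitened F e k ω none with hU₀
  have hwU : IsWhite P U 1 := hF.isWhite_whitened e k (some (e k))
  have hwU₀ : IsWhite P U₀ 1 := hF.isWhite_whitened e k none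
  set a := √(S.βBI k) * S.cosI k
  set b := √(S.βBI k) * S.sinI k
  set s := √(S.obsVar k)
  have hs : s ≠ 0 := (Real.sqrt_pos.2 (S.obsVar_pos k)).ne'
  -- In rotated coordinates `h = a U + b U₀` and `y = s U`, with `U` and `U₀` uncorrelated. Hence
  -- `C_hy = a s • 1` and `C_yy = s² • 1`, and the estimate is `a U`.
  have hh : ∀ ω m, S.h F k ω m = (a : ℂ) * U ω m + (b : ℂ) * U₀ ω m := fun ω m => by
    rw [h_eq_whitened e k]; rfl
  have hy : ∀ ω m, S.yI F k ω m = (s : ℂ) * U ω m := fun ω m => by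
    have := Yp_mulVec_φI_eq_whitened (F := F) e he k (e k) ω
    rw [Equiv.symm_apply_apply, he] at this
    rw [yI, pilotI, this, Pi.smul_apply, ← he]; rfl
  have hmy : mean P (S.yI F k) = 0 := by
    ext i
    simp_rw [mean, hy, integral_const_mul, hwU.mean]
    simp
  have hmh : mean P (S.h F k) = 0 := by
    ext i
    simp_rw [mean, hh]
    rw [integral_add (((hwU.memLp i).integrable one_le_two).const_mul _)
      (((hwU₀.memLp i).integrable one_le_two).const_mul _), integral_const_mul,
      integral_const_mul, hwU.mean, hwU₀.mean]
    simp
  have hcross : ∀ i j, ∫ ω, U₀ ω i * conj (U ω j) ∂P = 0 := fun i j => by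
    have hi : IndepFun (fun ω => U₀ ω i) (fun ω => conj (U ω j)) P :=
      ((hF.iIndepFun_whitened e k).indepFun (i := none) (j := some (e k)) (by simp)).comp
        (φ := fun x : Fin M → ℂ => x i) (ψ := fun x : Fin M → ℂ => conj (x j))
        (by fun_prop) (by fun_prop)
    rw [hi.integral_fun_mul_eq_mul_integral (hwU₀.memLp i).aestronglyMeasurable
      (memLp_conj (hwU.memLp j)).aestronglyMeasurable, hwU₀.mean, zero_mul]
  have hcyy : crossCov P (S.yI F k) (S.yI F k) = ((s ^ 2 : ℝ) : ℂ) • 1 := by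
    ext i j
    have : ∀ ω, S.yI F k ω i * conj (S.yI F k ω j) = ((s ^ 2 : ℝ) : ℂ) * (U ω i * conj (U ω j)) := by
      intro ω
      rw [hy, hy, map_mul, Complex.conj_ofReal]
      push_cast; ring
    simp [crossCov, hmy, this, integral_const_mul, hwU.cov, Matrix.one_apply]
  have hchy : crossCov P (S.h F k) (S.yI F k) = ((a * s : ℝ) : ℂ) • 1 := by
    ext i j
    have : ∀ ω, S.h F k ω i * conj (S.yI F k ω j) = ((a * s : ℝ) : ℂ) * (U ω i * conj (U ω j)) +
        ((b * s : ℝ) : ℂ) * (U₀ ω i * conj (U ω j)) := by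
      intro ω
      rw [hh, hy, map_mul, Complex.conj_ofReal]
      push_cast; ring
    have hint : ∫ ω, S.h F k ω i * conj (S.yI F k ω j) ∂P =
        ((a * s : ℝ) : ℂ) * if i = j then 1 else 0 := by
      simp_rw [this]
      rw [integral_add ((integrable_mul_conj (hwU.memLp i) (hwU.memLp j)).const_mul _)
        ((integrable_mul_conj (hwU₀.memLp i) (hwU.memLp j)).const_mul _), integral_const_mul,
        integral_const_mul, hwU.cov, hcross]
      simp
    simp [crossCov, hmy, hint, Matrix.one_apply]
  have hinv : ((((s ^ 2 : ℝ) : ℂ) • (1 : Matrix (Fin M) (Fin M) ℂ)))⁻¹ = ((s ^ 2 : ℝ) : ℂ)⁻¹ • 1 := by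
    refine Matrix.inv_eq_right_inv ?_
    have : ((s ^ 2 : ℝ) : ℂ) ≠ 0 := by exact_mod_cast pow_ne_zero 2 hs
    rw [smul_mul_smul_comm, mul_inv_cancel₀ this, one_smul, one_mul]
  have hest : ∀ ω, S.hHat P F k ω m = (a : ℂ) * U ω m := fun ω => by
    have hs' : (s : ℂ) ≠ 0 := by exact_mod_cast hs
    rw [hHat, mmse, hcyy, hchy, hinv, hmy, hmh, smul_mul_smul_comm, one_mul, Matrix.smul_mulVec,
      Matrix.one_mulVec]
    simp only [sub_zero, add_zero, Pi.smul_apply, smul_eq_mul, hy]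
    push_cast
    field_simp
  have hone : ∫ ω, ‖U ω m‖ ^ 2 ∂P = 1 := by
    have := hwU.cov m m
    simp_rw [Complex.mul_conj', if_true] at this
    rw [Complex.ofReal_one] at this
    have h2 := integral_complex_ofReal (f := fun ω => ‖U ω m‖ ^ 2) (μ := P)
    push_cast at h2
    rw [this] at h2
    exact_mod_cast h2.symm
  simp_rw [hest, norm_mul, mul_pow]
  rw [integral_const_mul, hone, Complex.norm_real, Real.norm_eq_abs, sq_abs, mul_pow,
    Real.sq_sqrt (S.βBI_pos k).le, mul_one, S.γ_eq (he ▸ e.injective)]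

lemma isWhite_h (hF : S.IsGaussian P F) (k : Fin KI) : IsWhite P (S.h F k) (S.βBI k) := by
  refine isWhite_of_iIndepFun (S.βBI_pos k).le (fun m => ?_) ?_
  · have hm : MeasurePreserving (fun z : ℂ => ((√(S.βBI k) : ℝ) : ℂ) * z) (complexGaussian 1)
        (complexGaussian (S.βBI k)) := by
      refine ⟨by fun_prop, ?_⟩
      rw [complexGaussian_map_smul zero_le_one, Real.sq_sqrt (S.βBI_pos k).le, mul_one]
    exact hm.comp_hasLaw (hF.law_H1t m k)
  · have hinj : Function.Injective
        (fun m : Fin M => (.inl (m, k) :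
          (Fin M × Fin KI) ⊕ (Fin M × Fin N) ⊕ (Fin M × Fin (τI + τE)))) := by
      intro m m' h
      simpa using h
    exact (hF.indep.precomp hinj).comp (fun _ z => (√(S.βBI k) : ℂ) * z)
      fun _ => measurable_const_mul _

lemma memLp_g (hF : S.IsGaussian P F) (l : Fin KE) (m : Fin M) :
    MemLp (fun ω => S.g F l ω m) 2 P := by
  simp_rw [g_apply]
  refine memLp_finsetSum _ fun n _ => ?_
  simp_rw [mul_comm _ ((S.Θ *ᵥ ((√(S.βRE l) : ℂ) • S.fbar l)) n)]
  exact memLp_const_mul (memLp_const_mul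
    (memLp_const_add (memLp_complexGaussian (hF.law_H2t m n)) _) _) _

lemma memLp_yE (hF : S.IsGaussian P F) (l : Fin KE) (m : Fin M) :
    MemLp (fun ω => S.yE F l ω m) 2 P := by
  have : ∀ ω, S.yE F l ω m = (√S.pilotEnergy : ℂ) *
      ∑ l', (star (S.pilotE l') ⬝ᵥ S.pilotE l) * S.g F l' ω m + (F.noise ω *ᵥ S.pilotE l) m := by
    intro ω
    rw [yE_eq]
    simp
  simp_rw [this]
  exact memLp_fun_add (memLp_const_mul
    (memLp_finsetSum _ fun l' _ => memLp_const_mul (hF.memLp_g l' m) _) _)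
    (hF.memLp_noise_mulVec _ m)

lemma memLp_estimate (hF : S.IsGaussian P F) {gEst : Fin KE → Ω → Fin M → ℂ}
    (h : gEst = S.gHat F ∨ gEst = S.gHatMMSE P F) (l : Fin KE) (m : Fin M) :
    MemLp (fun ω => gEst l ω m) 2 P := by
  obtain ⟨A, b, h⟩ := exists_affine_estimate h l
  simp only [h, Pi.add_apply, Matrix.mulVec, dotProduct]
  exact memLp_add_const (memLp_finsetSum _ fun s _ => memLp_const_mul (hF.memLp_yE l s) _) _

lemma isWhite_noise_row (hF : S.IsGaussian P F) (m : Fin M) :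
    IsWhite P (fun ω s => F.noise ω m s) S.σ2 := by
  refine isWhite_of_iIndepFun S.σ2_pos.le (fun s => hF.law_noise m s) ?_
  have hinj : Function.Injective
      (fun s => (.inr (.inr (m, s)) :
        (Fin M × Fin KI) ⊕ (Fin M × Fin N) ⊕ (Fin M × Fin (τI + τE)))) := by
    intro m m' h
    simpa using h
  exact hF.indep.precomp hinj

lemma integral_conj_noise_mulVec (hF : S.IsGaussian P F) (φ : Fin (τI + τE) → ℂ) (m : Fin M) :
    ∫ ω, conj ((F.noise ω *ᵥ φ) m) ∂P = 0 := by
  simp_rw [conj_noise_mulVec]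
  exact (hF.isWhite_noise_row m).integral_dotProduct (V := fun _ => star φ)
    (fun s => memLp_const _) (indepFun_const_right _ _)

lemma integral_norm_sq_noise_mulVec (hF : S.IsGaussian P F) (φ : Fin (τI + τE) → ℂ) (m : Fin M) :
    ∫ ω, ‖(F.noise ω *ᵥ φ) m‖ ^ 2 ∂P = S.σ2 * sqNorm φ := by
  have h := (hF.isWhite_noise_row m).integral_norm_sq_dotProduct (V := fun _ => star φ)
    (fun s => memLp_const _) (indepFun_const_right _ _)
  simp_rw [← conj_noise_mulVec, RCLike.norm_conj] at h
  rw [h]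
  simp [sqNorm]

lemma memLp_gHatResidual (hF : S.IsGaussian P F) (l : Fin KE) (m : Fin M) :
    MemLp (fun ω => S.gHatResidual l m (fun l' => S.g F l' ω)) 2 P := by
  simp only [gHatResidual, sub_eq_add_neg]
  exact memLp_add_const (memLp_const_mul (memLp_add_const (memLp_const_mul
    (memLp_finsetSum _ fun l' _ => memLp_const_mul (hF.memLp_g l' m) _) _) _) _) _

/-- The residual is independent of the centred noise and drops out, so only the noise component of
the estimate, with coefficient `cG`, contributes. Its nonvanishing gives the estimate positive
power. -/
lemma integral_gHat_mul_conj_noise (hF : S.IsGaussian P F) (l : Fin KE) (m : Fin M) :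
    ∫ ω, S.gHat F l ω m * conj ((F.noise ω *ᵥ S.pilotE l) m) ∂P = ((S.cG l * S.σ2 : ℝ) : ℂ) := by
  have hνL := hF.memLp_conj_noise_mulVec (S.pilotE l) m
  have hRL := hF.memLp_gHatResidual l m
  have hRν : IndepFun (fun ω => S.gHatResidual l m (fun l' => S.g F l' ω))
      (fun ω => conj ((F.noise ω *ᵥ S.pilotE l) m)) P :=
    hF.indepFun_gHatResidual_noise l m
  have h1 : ∀ ω, S.gHat F l ω m * conj ((F.noise ω *ᵥ S.pilotE l) m) =
      (S.cG l : ℂ) * ((‖(F.noise ω *ᵥ S.pilotE l) m‖ ^ 2 : ℝ) : ℂ) +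
        S.gHatResidual l m (fun l' => S.g F l' ω) * conj ((F.noise ω *ᵥ S.pilotE l) m) := by
    intro ω
    rw [gHat_apply, add_mul, mul_assoc, Complex.mul_conj']
    push_cast; rfl
  have hν := hF.memLp_noise_mulVec (S.pilotE l) m
  have hi : Integrable (fun ω => ((‖(F.noise ω *ᵥ S.pilotE l) m‖ ^ 2 : ℝ) : ℂ)) P :=
    ((memLp_two_iff_integrable_sq_norm hν.aestronglyMeasurable).1 hν).ofReal
  have hone : sqNorm (S.pilotE l) = 1 := by
    have h1 := S.φE_orthonormal (S.iE l) (S.iE l)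
    rw [if_pos rfl, star_dotProduct_self] at h1
    exact_mod_cast h1
  simp_rw [h1]
  rw [integral_add (hi.const_mul _) (integrable_mul_conj hRL hν), integral_const_mul,
    integral_complex_ofReal, hF.integral_norm_sq_noise_mulVec, hone,
    hRν.integral_fun_mul_eq_mul_integral hRL.aestronglyMeasurable hνL.aestronglyMeasurable,
    hF.integral_conj_noise_mulVec]
  simp

/-- The explicit estimate of the channel of an energy user does not vanish. -/
lemma integral_sqNorm_gHat_pos (hF : S.IsGaussian P F) (hτ : 0 < τI + τE) (hM : 0 < M)
    (l : Fin KE) : 0 < ∫ ω, sqNorm (S.gHat F l ω) ∂P := by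
  have hall : ∀ m', MemLp (fun ω => S.gHat F l ω m') 2 P :=
    hF.memLp_estimate (.inl rfl : S.gHat F = S.gHat F ∨ S.gHat F = S.gHatMMSE P F) l
  refine integral_sqNorm_pos hall (m := ⟨0, hM⟩)
    (Y := fun ω => conj ((F.noise ω *ᵥ S.pilotE l) ⟨0, hM⟩)) ?_
  rw [hF.integral_gHat_mul_conj_noise]
  exact_mod_cast (mul_pos (cG_pos hτ l) S.σ2_pos).ne'

end IsGaussian

end Params

-- Interference of the energy streams and assembly of the SINR.

namespace Params

variable {M N KI KE τI τE : ℕ} {S : Params M N KI KE τI τE}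
variable {Ω : Type*} [MeasurableSpace Ω] {P : Measure Ω} {F : Fading M N KI (τI + τE) Ω}

lemma IsGaussian.indepFun_h_estimate (hF : S.IsGaussian P F) {gEst : Fin KE → Ω → Fin M → ℂ}
    (h : gEst = S.gHat F ∨ gEst = S.gHatMMSE P F) (k : Fin KI) (l : Fin KE) :
    IndepFun (S.h F k) (gEst l) P := by
  obtain ⟨A, b, h⟩ := exists_affine_estimate h l
  rw [h]
  exact (hF.indepFun_h_yE k l).comp measurable_id ((measurable_mulVec A).add_const b)

/-- The gain of an information user for a unit-power precoder built from an independent estimate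
has the mean square of its channel coefficients. -/
lemma IsGaussian.integral_norm_sq_gain_normalize [IsProbabilityMeasure P]
    (hF : S.IsGaussian P F) (k : Fin KI)
    {V : Ω → Fin M → ℂ} (hV : ∀ m, MemLp (fun ω => V ω m) 2 P) (h : IndepFun (S.h F k) V P)
    (hpos : 0 < ∫ ω, sqNorm (V ω) ∂P) :
    ∫ ω, ‖S.gain F k (normalize P V) ω‖ ^ 2 ∂P = S.βBI k := by
  have := (hF.isWhite_h k).integral_norm_sq_dotProduct (memLp_normalize hV) (indepFun_normalize h)
  rwa [integral_sqNorm_normalize hpos, mul_one] at this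

/-- Effective SINR for precoders with the gain statistics of partial zero-forcing. -/
lemma sinr_eq_of_gains {wI : Fin KI → Ω → Fin M → ℂ} {wE : Fin KE → Ω → Fin M → ℂ} {k : Fin KI}
    {a c : ℝ} (hmean : ‖∫ ω, S.gain F k (wI k) ω ∂P‖ ^ 2 = a)
    (hI : ∀ t, ∫ ω, ‖S.gain F k (wI t) ω‖ ^ 2 ∂P = (if t = k then a else 0) + c)
    (hE : ∀ l, ∫ ω, ‖S.gain F k (wE l) ω‖ ^ 2 ∂P = S.βBI k) :
    S.sinr P F wI wE k =
      S.ρI k * a / (∑ t, S.ρI t * c + ∑ l, S.ρE l * S.βBI k + 1) := by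
  rw [sinr, hmean]
  -- The indicator picks out `ρI k * a` from the own stream, which cancels the subtracted power of
  -- the mean gain in the denominator.
  simp_rw [hI, hE, mul_add, Finset.sum_add_distrib, mul_ite, mul_zero]
  rw [Finset.sum_ite_eq' Finset.univ k, if_pos (Finset.mem_univ k)]
  congr 1
  ring

end Params
end SWIPT
end

theorem corollary1 {M N KI KE τI τE : ℕ} (S : SWIPT.Params M N KI KE τI τE)
    {Ω : Type*} [MeasurableSpace Ω] (P : MeasureTheory.Measure Ω)
    [MeasureTheory.IsProbabilityMeasure P]
    (F : SWIPT.Fading M N KI (τI + τE) Ω) (hF : S.IsGaussian P F)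
    -- no pilot reuse: each pilot of the IU pilot book is used by exactly one IU
    (hpilot : Function.Bijective S.iI) (hM : KI < M) (k : Fin KI) :
    -- `γ` is the mean square of each entry of the MMSE estimate
    (∀ m, ∫ ω, ‖S.hHat P F k ω m‖ ^ 2 ∂P = S.γ k) ∧
    -- the PZF precoders are well defined, of unit mean power, with square integrable gains
    (∀ᵐ ω ∂P, IsUnit ((S.H1hat F ω).conjTranspose * S.H1hat F ω)) ∧
    (∀ t, ∫ ω, SWIPT.sqNorm (S.wPZF P F t ω) ∂P = 1) ∧
    (∀ t, MeasureTheory.MemLp (S.gain F k (S.wPZF P F t)) 2 P) ∧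
    -- for both forms of the estimates of the EU channels, and the MRT precoders built from them
    (∀ gEst : Fin KE → Ω → Fin M → ℂ,
      (gEst = S.gHat F ∨
        gEst = S.gHatMMSE P F ∧ ∀ l, 0 < ∫ ω, SWIPT.sqNorm (gEst l ω) ∂P) →
      (∀ l, ∫ ω, SWIPT.sqNorm (SWIPT.normalize P (gEst l) ω) ∂P = 1) ∧
      (∀ l, MeasureTheory.MemLp (S.gain F k (SWIPT.normalize P (gEst l))) 2 P) ∧
      S.sinr P F (S.wPZF P F) (fun l => SWIPT.normalize P (gEst l)) k =
        ((M : ℝ) - KI) * S.ρI k * S.γ k /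
          (∑ t, S.ρI t * (S.βBI k - S.γ k) + ∑ l, S.ρE l * S.βBI k + 1) ∧
      S.spectralEff P F (S.wPZF P F) (fun l => SWIPT.normalize P (gEst l)) k =
        (1 - ((τI + τE : ℕ) : ℝ) / S.τc) *
          Real.logb 2 (1 + ((M : ℝ) - KI) * S.ρI k * S.γ k /
            (∑ t, S.ρI t * (S.βBI k - S.γ k) + ∑ l, S.ρE l * S.βBI k + 1))) := by
  let e : Fin KI ≃ Fin τI := Equiv.ofBijective S.iI hpilot
  have he : ⇑e = S.iI := rfl
  have hcard : KI = τI := by simpa using Fintype.card_congr e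
  have hM' : τI < M := hcard ▸ hM
  have hcard' : (KI : ℝ) = τI := congrArg Nat.cast hcard
  refine ⟨hF.integral_norm_sq_hHat he k, hF.ae_isUnit_gram he hM' k,
    hF.integral_sqNorm_wPZF he hM', hF.memLp_gain_wPZF he hM' k, fun gEst hg => ?_⟩
  have hg' : gEst = S.gHat F ∨ gEst = S.gHatMMSE P F := hg.imp_right And.left
  have hpos : ∀ l, 0 < ∫ ω, SWIPT.sqNorm (gEst l ω) ∂P := by
    rcases hg with rfl | ⟨-, h⟩
    -- The user `k` itself forces `KI ≥ 1`, hence pilots of positive length and, with `KI < M`, at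
    -- least one antenna.
    · exact fun l => hF.integral_sqNorm_gHat_pos (by have := k.pos; omega) (by omega) l
    · exact h
  have hL := hF.memLp_estimate hg'
  have hind := hF.indepFun_h_estimate hg' k
  have hsinr : S.sinr P F (S.wPZF P F) (fun l => SWIPT.normalize P (gEst l)) k =
      ((M : ℝ) - KI) * S.ρI k * S.γ k /
        (∑ t, S.ρI t * (S.βBI k - S.γ k) + ∑ l, S.ρE l * S.βBI k + 1) := by
    rw [SWIPT.Params.sinr_eq_of_gains (hF.norm_sq_integral_gain_wPZF he hM' k)
      (hF.integral_norm_sq_gain_wPZF he hM' k)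
      (fun l => hF.integral_norm_sq_gain_normalize k (hL l) (hind l) (hpos l)), hcard']
    congr 1
    ring
  refine ⟨fun l => SWIPT.integral_sqNorm_normalize (hpos l), fun l =>
    (hF.isWhite_h k).memLp_dotProduct (SWIPT.memLp_normalize (hL l))
      (SWIPT.indepFun_normalize (hind l)), hsinr, ?_⟩
  rw [SWIPT.Params.spectralEff, hsinr]
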